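/- Let $(\Omega,\mathcal A,\mu)$ be a $\sigma$-finite measure space and $(\Omega_i)_{i\in I}$ an at most countable partition of $\Omega$ into measurable sets with $0<\mu(\Omega_i)<\infty$. In $L^0(\Omega,\mathcal A,\mu)$ (a.e. classes of measurable real functions, with pointwise a.e. order and multiplication) put $$L^1(T)=\{f\in L^0 : f\mathbf 1_{\Omega_i}\in L^1(\mu)\text{ for all } i\in I\},\qquad T f=\sum_{i\in I}\Big(\frac1{\mu(\Omega_i)}\int_{\Omega_i} f\,d\mu\Big)\mathbf 1_{\Omega_i}\quad(f\in L^1(T)),$$ let $R(T)$ be the range of $T$ (the functions that are a.e. constant on each $\Omega_i$; a Dedekind complete Riesz space and a subalgebra of $L^0$), and let $$L^\infty(T)=\{f\in L^1(T):\exists g\in R(T)_+,\ |f|\le g\},\qquad \|f\|_{T,\infty}=\inf\{g\in R(T)_+ : |f|\le g\},$$ with infima taken in $R(T)$. The $T$-strong dual $\widehat{L^\infty(T)}$ is the set of all $R(T)$-linear maps $\varphi:L^\infty(T)\to R(T)$ that are regular (a difference of two positive linear operators) and for which some $g\in R(T)_+$ satisfies $|\varphi(f)|\le g\,\|f\|_{T,\infty}$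 for all $f\in L^\infty(T)$; $\|\varphi\|_{\widehat{L^\infty(T)}}\in R(T)$ is the infimum of all such $g$. It is an $R(T)$-module with pointwise operations and is ordered by $\varphi\le\psi$ iff $\varphi(f)\le\psi(f)$ for all $f\ge0$. For $i\in I$ let $T_i f=\big(\frac1{\mu(\Omega_i)}\int_{\Omega_i}f\,d\mu\big)\mathbf 1_{\Omega_i}$ on $L^1(\Omega_i)$, i.e. the operator obtained in the same way from the one-set partition of $\Omega_i$ (with the restricted $\sigma$-algebra and measure), and define $R(T_i)$, $L^\infty(T_i)$, $\widehat{L^\infty(T_i)}$ and its norm accordingly. For a function $f$ on $\Omega_i$ let $\overline f^{\,i}$ be its extension by $0$ to $\Omega$. The product $\prod_{i\in I}\widehat{L^\infty(T_i)}$ carries the coordinatewise order, the $R(T)$-module structure $(g\varphi)_i=g|_{\Omega_i}\varphi_i$, and the $R(T)$-valued norm $\|(\varphi_i)_i\|=\sum_{i\in I}\overline{\|\varphi_i\|_{\widehat{L^\infty(T_i)}}}^{\,i}$. Then: (a) For every $(\varphi_i)_i\in\prod_{i\in I}\widehat{L^\infty(T_i)}$ the map $\varphi: f\mapsto\sum_{i\in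 I}\overline{\varphi_i(f|_{\Omega_i})}^{\,i}$ belongs to $\widehat{L^\infty(T)}$, and $\|\varphi\|_{\widehat{L^\infty(T)}}\le\|(\varphi_i)_i\|$. (b) For every $\varphi\in\widehat{L^\infty(T)}$ and $i\in I$ the map $\varphi_i: L^\infty(T_i)\to R(T_i)$, $f\mapsto\varphi(\overline f^{\,i})|_{\Omega_i}$, belongs to $\widehat{L^\infty(T_i)}$, and $\|(\varphi_i)_i\|\le\|\varphi\|_{\widehat{L^\infty(T)}}$. (c) $\prod_{i\in I}\widehat{L^\infty(T_i)}$ and $\widehat{L^\infty(T)}$ are Riesz spaces, and the maps $$\Phi:\prod_{i\in I}\widehat{L^\infty(T_i)}\to\widehat{L^\infty(T)},\ (\varphi_i)_i\mapsto\Big(f\mapsto\sum_{i\in I}\overline{\varphi_i(f|_{\Omega_i})}^{\,i}\Big),\qquad \Psi:\widehat{L^\infty(T)}\to\prod_{i\in I}\widehat{L^\infty(T_i)},\ \varphi\mapsto\Big(f\mapsto\varphi(\overline f^{\,i})|_{\Omega_i}\Big)_{i\in I},$$ are mutually inverse $R(T)$-linear isometric Riesz isomorphisms. -/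

import Mathlib

open MeasureTheory

set_option linter.unusedSectionVars false

noncomputable section

namespace StrongDual

universe u v

/-! ### The algebra `L⁰(Ω, 𝒜, μ)` of a.e. classes of measurable real functions

Mathlib provides its order, its additive group and its multiplicative monoid structure; the
following instances put them together. -/

section L0

variable {Ω : Type u} [MeasurableSpace Ω] {μ : Measure Ω}

instance instCommRingL0 : CommRing (Ω →ₘ[μ] ℝ) :=
  { (inferInstance : AddCommGroup (Ω →ₘ[μ] ℝ)), (inferInstance : CommMonoid (Ω →ₘ[μ] ℝ)) with
    left_distrib := fun a b c => by
      apply AEEqFun.ext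
      filter_upwards [AEEqFun.coeFn_mul a (b + c), AEEqFun.coeFn_add b c,
        AEEqFun.coeFn_add (a * b) (a * c), AEEqFun.coeFn_mul a b, AEEqFun.coeFn_mul a c]
        with x h1 h2 h3 h4 h5
      simp only [Pi.add_apply, Pi.mul_apply] at *
      rw [h1, h2, h3, h4, h5]; ring
    right_distrib := fun a b c => by
      apply AEEqFun.ext
      filter_upwards [AEEqFun.coeFn_mul (a + b) c, AEEqFun.coeFn_add a b,
        AEEqFun.coeFn_add (a * c) (b * c), AEEqFun.coeFn_mul a c, AEEqFun.coeFn_mul b c]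
        with x h1 h2 h3 h4 h5
      simp only [Pi.add_apply, Pi.mul_apply] at *
      rw [h1, h2, h3, h4, h5]; ring
    zero_mul := fun a => by
      apply AEEqFun.ext
      filter_upwards [AEEqFun.coeFn_mul 0 a, AEEqFun.coeFn_zero (α := Ω) (μ := μ) (β := ℝ)]
        with x h1 h2
      simp only [Pi.mul_apply, Pi.zero_apply] at *
      rw [h1, h2, zero_mul]
    mul_zero := fun a => by
      apply AEEqFun.ext
      filter_upwards [AEEqFun.coeFn_mul a 0, AEEqFun.coeFn_zero (α := Ω) (μ := μ) (β := ℝ)]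
        with x h1 h2
      simp only [Pi.mul_apply, Pi.zero_apply] at *
      rw [h1, h2, mul_zero] }

instance instAlgebraL0 : Algebra ℝ (Ω →ₘ[μ] ℝ) :=
  Algebra.ofModule
    (fun r a b => by
      apply AEEqFun.ext
      filter_upwards [AEEqFun.coeFn_mul (r • a) b, AEEqFun.coeFn_smul r a,
        AEEqFun.coeFn_smul r (a * b), AEEqFun.coeFn_mul a b] with x h1 h2 h3 h4
      simp only [Pi.mul_apply, Pi.smul_apply, smul_eq_mul] at *
      rw [h1, h2, h3, h4]; ring)
    (fun r a b => by
      apply AEEqFun.ext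
      filter_upwards [AEEqFun.coeFn_mul a (r • b), AEEqFun.coeFn_smul r b,
        AEEqFun.coeFn_smul r (a * b), AEEqFun.coeFn_mul a b] with x h1 h2 h3 h4
      simp only [Pi.mul_apply, Pi.smul_apply, smul_eq_mul] at *
      rw [h1, h2, h3, h4]; ring)

instance instIsOrderedAddMonoidL0 : IsOrderedAddMonoid (Ω →ₘ[μ] ℝ) where
  add_le_add_left a b h c := by
    rw [← AEEqFun.coeFn_le] at h ⊢
    filter_upwards [h, AEEqFun.coeFn_add a c, AEEqFun.coeFn_add b c] with x h1 h2 h3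
    rw [h2, h3, Pi.add_apply, Pi.add_apply]
    linarith

end L0

/-- An at most countable partition of a measure space into measurable sets of positive finite
measure (countability of the index type is a separate instance argument). -/
structure FinPartition {Ω : Type u} [MeasurableSpace Ω] (μ : Measure Ω) (ι : Type v) where
  /-- the cells of the partition -/
  cell : ι → Set Ω
  measurableSet_cell : ∀ i, MeasurableSet (cell i)
  disjoint : ∀ i j, i ≠ j → Disjoint (cell i) (cell j)
  iUnion_cell : ⋃ i, cell i = Set.univ
  pos : ∀ i, 0 < μ (cell i)
  lt_top : ∀ i, μ (cell i) < ⊤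

namespace FinPartition

section Basic

variable {Ω : Type u} [MeasurableSpace Ω] {μ : Measure Ω} {ι : Type v} [Countable ι]
  (P : FinPartition μ ι)

theorem ae_iff {p : Ω → Prop} :
    (∀ᵐ ω ∂μ, p ω) ↔ ∀ i, ∀ᵐ ω ∂(μ.restrict (P.cell i)), p ω := by
  rw [← ae_restrict_iUnion_iff, P.iUnion_cell, Measure.restrict_univ]

theorem ae_mem (i : ι) : ∀ᵐ ω ∂(μ.restrict (P.cell i)), ω ∈ P.cell i :=
  ae_restrict_mem (P.measurableSet_cell i)

theorem restrict_of_ae {p : Ω → Prop} (h : ∀ᵐ ω ∂μ, p ω) (i : ι) :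
    ∀ᵐ ω ∂(μ.restrict (P.cell i)), p ω := P.ae_iff.1 h i

theorem neBot_ae_restrict (i : ι) : (ae (μ.restrict (P.cell i))).NeBot :=
  MeasureTheory.ae_restrict_neBot.2 (P.pos i).ne'

theorem finite_restrict (i : ι) : IsFiniteMeasure (μ.restrict (P.cell i)) :=
  ⟨by rw [Measure.restrict_apply_univ]; exact P.lt_top i⟩

theorem tsum_indicator {c : ι → Ω → ℝ} {i : ι} {ω : Ω} (h : ω ∈ P.cell i) :
    ∑' j, (P.cell j).indicator (c j) ω = c i ω := by
  rw [tsum_eq_single i, Set.indicator_of_mem h]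
  intro j hj
  exact Set.indicator_of_notMem (fun hj' => (P.disjoint j i hj).notMem_of_mem_left hj' h) _

/-- The function `∑ i, c i • 1_{Ω_i}`. -/
def step (c : ι → ℝ) : Ω →ₘ[μ] ℝ :=
  AEEqFun.mk (fun ω => ∑' i, (P.cell i).indicator (fun _ => c i) ω)
    (Measurable.tsum fun i =>
      measurable_const.indicator (P.measurableSet_cell i)).aestronglyMeasurable

theorem coeFn_step (c : ι → ℝ) :
    ∀ᵐ ω ∂μ, P.step c ω = ∑' i, (P.cell i).indicator (fun _ => c i) ω :=
  AEEqFun.coeFn_mk _ _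

theorem step_ae (c : ι → ℝ) (i : ι) :
    ∀ᵐ ω ∂(μ.restrict (P.cell i)), P.step c ω = c i := by
  filter_upwards [P.restrict_of_ae (P.coeFn_step c) i, P.ae_mem i] with ω h1 h2
  rw [h1]
  exact P.tsum_indicator (c := fun i _ => c i) h2

theorem eq_of_ae {f g : Ω →ₘ[μ] ℝ}
    (h : ∀ i, ∀ᵐ ω ∂(μ.restrict (P.cell i)), f ω = g ω) : f = g :=
  AEEqFun.ext (P.ae_iff.2 h)

theorem le_iff_ae {f g : Ω →ₘ[μ] ℝ} :
    f ≤ g ↔ ∀ i, ∀ᵐ ω ∂(μ.restrict (P.cell i)), f ω ≤ g ω := by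
  rw [← AEEqFun.coeFn_le]; exact P.ae_iff

theorem eq_step {f : Ω →ₘ[μ] ℝ} {c : ι → ℝ}
    (h : ∀ i, ∀ᵐ ω ∂(μ.restrict (P.cell i)), f ω = c i) : f = P.step c :=
  P.eq_of_ae fun i => by
    filter_upwards [h i, P.step_ae c i] with ω h1 h2
    rw [h1, h2]

theorem step_le_step {c d : ι → ℝ} : P.step c ≤ P.step d ↔ c ≤ d := by
  rw [P.le_iff_ae]
  constructor
  · intro h i
    have := P.neBot_ae_restrict i
    obtain ⟨ω, h1, h2, h3⟩ := ((h i).and ((P.step_ae c i).and (P.step_ae d i))).exists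
    rwa [h2, h3] at h1
  · intro h i
    filter_upwards [P.step_ae c i, P.step_ae d i] with ω h2 h3
    rw [h2, h3]; exact h i

theorem step_add (c d : ι → ℝ) : P.step c + P.step d = P.step (c + d) :=
  P.eq_step fun i => by
    filter_upwards [P.step_ae c i, P.step_ae d i,
      P.restrict_of_ae (AEEqFun.coeFn_add (P.step c) (P.step d)) i] with ω h1 h2 h3
    rw [h3, Pi.add_apply, h1, h2, Pi.add_apply]

theorem step_mul (c d : ι → ℝ) : P.step c * P.step d = P.step (c * d) :=
  P.eq_step fun i => by
    filter_upwards [P.step_ae c i, P.step_ae d i,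
      P.restrict_of_ae (AEEqFun.coeFn_mul (P.step c) (P.step d)) i] with ω h1 h2 h3
    rw [h3, Pi.mul_apply, h1, h2, Pi.mul_apply]

theorem step_smul (r : ℝ) (c : ι → ℝ) : r • P.step c = P.step (r • c) :=
  P.eq_step fun i => by
    filter_upwards [P.step_ae c i, P.restrict_of_ae (AEEqFun.coeFn_smul r (P.step c)) i]
      with ω h1 h3
    rw [h3, Pi.smul_apply, h1, Pi.smul_apply]

theorem step_abs (c : ι → ℝ) : |P.step c| = P.step |c| :=
  P.eq_step fun i => by
    filter_upwards [P.step_ae c i, P.restrict_of_ae (AEEqFun.coeFn_abs (P.step c)) i]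
      with ω h1 h3
    rw [h3, h1, Pi.abs_apply]

theorem step_zero : P.step 0 = 0 :=
  (P.eq_step fun i => by
    filter_upwards [P.restrict_of_ae (AEEqFun.coeFn_zero (μ := μ) (β := ℝ)) i] with ω h
    rw [h]; rfl).symm

theorem step_one : P.step 1 = 1 :=
  (P.eq_step fun i => by
    filter_upwards [P.restrict_of_ae (AEEqFun.coeFn_one (μ := μ) (β := ℝ)) i] with ω h
    rw [h]; rfl).symm

theorem step_nonneg {c : ι → ℝ} : 0 ≤ P.step c ↔ 0 ≤ c := by
  rw [← P.step_zero, P.step_le_step]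

/-! ### The conditional expectation, its range, and `L^∞(T)` -/

/-- The space `L¹(T)`, realized inside `L⁰` (the universal completion of `L¹(Ω, 𝒜, μ)`): all
`f ∈ L⁰` with `f • 1_{Ω_i}` integrable for every `i`. -/
def L1 : Submodule ℝ (Ω →ₘ[μ] ℝ) where
  carrier := {f | ∀ i, IntegrableOn f (P.cell i) μ}
  add_mem' := fun {f g} hf hg i =>
    ((hf i).add (hg i)).congr (P.restrict_of_ae (AEEqFun.coeFn_add f g).symm i)
  zero_mem' := fun i =>
    (integrable_zero _ _ _).congr (P.restrict_of_ae AEEqFun.coeFn_zero.symm i)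
  smul_mem' := fun r f hf i =>
    ((hf i).smul r).congr (P.restrict_of_ae (AEEqFun.coeFn_smul r f).symm i)

/-- The mean value `(1 / μ(Ω_i)) ∫_{Ω_i} f dμ`. -/
def mean (f : Ω → ℝ) (i : ι) : ℝ := 1 / μ.real (P.cell i) * ∫ ω in P.cell i, f ω ∂μ

theorem step_mem_L1 (c : ι → ℝ) : P.step c ∈ P.L1 := fun i => by
  have := P.finite_restrict i
  exact (integrable_const (c i)).congr (by
    filter_upwards [P.step_ae c i] with ω h using h.symm)

theorem mean_step (c : ι → ℝ) : P.mean (P.step c) = c := by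
  funext i
  have h : μ.real (P.cell i) ≠ 0 := (ENNReal.toReal_pos (P.pos i).ne' (P.lt_top i).ne).ne'
  rw [mean, integral_congr_ae (P.step_ae c i)]
  simp only [integral_const, measureReal_restrict_apply_univ, smul_eq_mul]
  field_simp

/-- The (maximally extended) conditional expectation
`T f = ∑ i, ((1 / μ(Ω_i)) ∫_{Ω_i} f dμ) • 1_{Ω_i}` on `L¹(T)`. -/
def T : P.L1 →ₗ[ℝ] P.L1 where
  toFun f := ⟨P.step (P.mean f.1), P.step_mem_L1 _⟩
  map_add' f g := by
    apply Subtype.ext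
    change P.step (P.mean (f.1 + g.1 : Ω →ₘ[μ] ℝ)) = P.step _ + P.step _
    rw [P.step_add]
    congr 1
    funext i
    rw [Pi.add_apply, mean, mean, mean, ← mul_add, ← integral_add (f.2 i) (g.2 i)]
    congr 1
    exact integral_congr_ae (P.restrict_of_ae (AEEqFun.coeFn_add f.1 g.1) i)
  map_smul' r f := by
    apply Subtype.ext
    change P.step (P.mean (r • f.1 : Ω →ₘ[μ] ℝ)) = r • P.step _
    rw [P.step_smul]
    congr 1
    funext i
    have h : ∫ ω in P.cell i, (r • f.1 : Ω →ₘ[μ] ℝ) ω ∂μ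
        = ∫ ω in P.cell i, r * f.1 ω ∂μ :=
      integral_congr_ae (P.restrict_of_ae (AEEqFun.coeFn_smul r f.1) i)
    rw [Pi.smul_apply, mean, mean, h, integral_const_mul, smul_eq_mul]
    ring

theorem exists_T_eq_iff {g : Ω →ₘ[μ] ℝ} :
    (∃ f : P.L1, (P.T f : Ω →ₘ[μ] ℝ) = g) ↔ ∃ c, g = P.step c := by
  constructor
  · rintro ⟨f, rfl⟩
    exact ⟨_, rfl⟩
  · rintro ⟨c, rfl⟩
    exact ⟨⟨P.step c, P.step_mem_L1 c⟩, congrArg P.step (P.mean_step c)⟩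

/-- The range `R(T)`, which is a subalgebra of `L⁰`. -/
def R : Subalgebra ℝ (Ω →ₘ[μ] ℝ) where
  carrier := {g | ∃ f : P.L1, (P.T f : Ω →ₘ[μ] ℝ) = g}
  mul_mem' := fun {a b} ha hb => by
    obtain ⟨c, rfl⟩ := P.exists_T_eq_iff.1 ha
    obtain ⟨d, rfl⟩ := P.exists_T_eq_iff.1 hb
    exact P.exists_T_eq_iff.2 ⟨_, P.step_mul c d⟩
  add_mem' := fun {a b} ha hb => by
    obtain ⟨c, rfl⟩ := P.exists_T_eq_iff.1 ha
    obtain ⟨d, rfl⟩ := P.exists_T_eq_iff.1 hb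
    exact P.exists_T_eq_iff.2 ⟨_, P.step_add c d⟩
  algebraMap_mem' := fun r => P.exists_T_eq_iff.2 ⟨r • 1, by
    rw [Algebra.algebraMap_eq_smul_one, ← P.step_one, P.step_smul]⟩

theorem mem_R {g : Ω →ₘ[μ] ℝ} : g ∈ P.R ↔ ∃ c, g = P.step c := P.exists_T_eq_iff

theorem step_mem_R (c : ι → ℝ) : P.step c ∈ P.R := P.mem_R.2 ⟨c, rfl⟩

/-- `R(T)` is Dedekind complete. -/
theorem exists_isGLB (S : Set P.R) (hne : S.Nonempty) (hb : BddBelow S) :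
    ∃ g, IsGLB S g := by
  have hS : ∀ a : P.R, ∃ c, (a : Ω →ₘ[μ] ℝ) = P.step c := fun a => P.mem_R.1 a.2
  choose val hval using hS
  have hle : ∀ a b : P.R, a ≤ b ↔ val a ≤ val b := fun a b => by
    rw [← P.step_le_step, ← hval, ← hval]; rfl
  obtain ⟨l, hl⟩ := hb
  have := hne.to_subtype
  have hbd : ∀ i, BddBelow (Set.range fun a : S => val a.1 i) := fun i =>
    ⟨val l i, by rintro _ ⟨a, rfl⟩; exact (hle _ _).1 (hl a.2) i⟩
  refine ⟨⟨P.step fun i => ⨅ a : S, val a.1 i, P.step_mem_R _⟩, ?_, ?_⟩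
  · intro a ha
    change P.step _ ≤ a.1
    rw [hval a, P.step_le_step]
    exact fun i => ciInf_le (hbd i) ⟨a, ha⟩
  · intro b hb
    change b.1 ≤ P.step _
    rw [hval b, P.step_le_step]
    exact fun i => le_ciInf fun a => (hle _ _).1 (hb a.2) i

theorem smul_ae {c : ι → ℝ} (f : Ω →ₘ[μ] ℝ) (i : ι) :
    ∀ᵐ ω ∂(μ.restrict (P.cell i)), (P.step c * f) ω = c i * f ω := by
  filter_upwards [P.step_ae c i, P.restrict_of_ae (AEEqFun.coeFn_mul (P.step c) f) i]
    with ω h1 h2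
  rw [h2, Pi.mul_apply, h1]

/-- `L^∞(T) = {f ∈ L¹(T) | ∃ g ∈ R(T)₊, |f| ≤ g}`, an `R(T)`-submodule of `L⁰`. -/
def Linf : Submodule P.R (Ω →ₘ[μ] ℝ) where
  carrier := {f | f ∈ P.L1 ∧ ∃ g ∈ P.R, 0 ≤ g ∧ |f| ≤ g}
  add_mem' := fun {f f'} hf hf' => by
    obtain ⟨hf, g, hg, hg0, hfg⟩ := hf
    obtain ⟨hf', g', hg', hg0', hfg'⟩ := hf'
    obtain ⟨c, rfl⟩ := P.mem_R.1 hg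
    obtain ⟨c', rfl⟩ := P.mem_R.1 hg'
    refine ⟨add_mem hf hf', _, add_mem hg hg', ?_, ?_⟩
    · rw [P.step_add, P.step_nonneg]
      exact add_nonneg (P.step_nonneg.1 hg0) (P.step_nonneg.1 hg0')
    · rw [P.step_add, P.le_iff_ae]
      rw [P.le_iff_ae] at hfg hfg'
      intro i
      filter_upwards [hfg i, hfg' i, P.step_ae c i, P.step_ae c' i, P.step_ae (c + c') i,
        P.restrict_of_ae (AEEqFun.coeFn_abs f) i, P.restrict_of_ae (AEEqFun.coeFn_abs f') i,
        P.restrict_of_ae (AEEqFun.coeFn_abs (f + f')) i,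
        P.restrict_of_ae (AEEqFun.coeFn_add f f') i] with ω h1 h2 h3 h4 h5 h6 h7 h8 h9
      rw [h8, h9, h5, Pi.add_apply, Pi.add_apply]
      rw [h6, h3] at h1
      rw [h7, h4] at h2
      exact (abs_add_le _ _).trans (add_le_add h1 h2)
  zero_mem' := ⟨zero_mem _, 0, zero_mem _, le_rfl, by rw [abs_zero]⟩
  smul_mem' := fun a f hf => by
    obtain ⟨hf, g, hg, hg0, hfg⟩ := hf
    obtain ⟨c, rfl⟩ := P.mem_R.1 hg
    obtain ⟨a, ha⟩ := a
    obtain ⟨d, rfl⟩ := P.mem_R.1 ha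
    change P.step d * f ∈ P.L1 ∧ ∃ g ∈ P.R, 0 ≤ g ∧ |P.step d * f| ≤ g
    refine ⟨fun i => ((hf i).const_mul (d i)).congr ?_, P.step (|d| * c), P.step_mem_R _, ?_, ?_⟩
    · filter_upwards [P.smul_ae (c := d) f i] with ω h using h.symm
    · exact P.step_nonneg.2 (mul_nonneg (abs_nonneg d) (P.step_nonneg.1 hg0))
    · rw [P.le_iff_ae] at hfg ⊢
      intro i
      filter_upwards [hfg i, P.step_ae c i, P.step_ae (|d| * c) i, P.smul_ae (c := d) f i,
        P.restrict_of_ae (AEEqFun.coeFn_abs f) i,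
        P.restrict_of_ae (AEEqFun.coeFn_abs (P.step d * f)) i] with ω h1 h2 h3 h4 h5 h6
      rw [h6, h4, h3, abs_mul]
      rw [h5, h2] at h1
      exact mul_le_mul_of_nonneg_left h1 (abs_nonneg (d i))

/-- The `R(T)`-valued norm on `L^∞(T)` is the infimum of this subset of `R(T)`. -/
def normSet (f : P.Linf) : Set P.R := {a | 0 ≤ a ∧ |(f : Ω →ₘ[μ] ℝ)| ≤ (a : Ω →ₘ[μ] ℝ)}

theorem exists_isGLB_normSet (f : P.Linf) : ∃ g, IsGLB (P.normSet f) g := by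
  obtain ⟨-, g, hg, hg0, hfg⟩ := f.2
  exact P.exists_isGLB _ ⟨⟨g, hg⟩, hg0, hfg⟩ ⟨0, fun a ha => ha.1⟩

/-- `‖f‖_{T,∞} = inf {a ∈ R(T)₊ | |f| ≤ a}`, the infimum being taken in `R(T)`. -/
def normInf (f : P.Linf) : P.R := (P.exists_isGLB_normSet f).choose

theorem isGLB_normInf (f : P.Linf) : IsGLB (P.normSet f) (P.normInf f) :=
  (P.exists_isGLB_normSet f).choose_spec

theorem normInf_nonneg (f : P.Linf) : 0 ≤ P.normInf f :=
  (P.isGLB_normInf f).2 fun _ ha => ha.1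

/-! ### The `T`-strong dual of `L^∞(T)` -/

/-- A map into `R(T)` is regular if it is a difference of two positive linear operators. -/
def IsRegular (φ : P.Linf → P.R) : Prop :=
  ∃ ψ₁ ψ₂ : P.Linf →ₗ[ℝ] P.R,
    (∀ f : P.Linf, 0 ≤ f → 0 ≤ ψ₁ f) ∧ (∀ f : P.Linf, 0 ≤ f → 0 ≤ ψ₂ f) ∧
      ∀ f, φ f = ψ₁ f - ψ₂ f

/-- The set of all `g ∈ R(T)₊` with `|φ f| ≤ g ‖f‖_{T,∞}` for all `f ∈ L^∞(T)`. -/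
def boundSet (φ : P.Linf → P.R) : Set P.R :=
  {g | 0 ≤ g ∧ ∀ f, |(φ f : Ω →ₘ[μ] ℝ)| ≤ ((g * P.normInf f : P.R) : Ω →ₘ[μ] ℝ)}

theorem add_nonneg_R {a b : P.R} (ha : 0 ≤ a) (hb : 0 ≤ b) : 0 ≤ a + b := by
  obtain ⟨a, ha'⟩ := a
  obtain ⟨b, hb'⟩ := b
  obtain ⟨c, rfl⟩ := P.mem_R.1 ha'
  obtain ⟨d, rfl⟩ := P.mem_R.1 hb'
  change 0 ≤ P.step c at ha
  change 0 ≤ P.step d at hb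
  change 0 ≤ P.step c + P.step d
  rw [P.step_nonneg] at ha hb
  rw [P.step_add, P.step_nonneg]
  exact add_nonneg ha hb

theorem mul_nonneg_R {a b : P.R} (ha : 0 ≤ a) (hb : 0 ≤ b) : 0 ≤ a * b := by
  obtain ⟨a, ha'⟩ := a
  obtain ⟨b, hb'⟩ := b
  obtain ⟨c, rfl⟩ := P.mem_R.1 ha'
  obtain ⟨d, rfl⟩ := P.mem_R.1 hb'
  change 0 ≤ P.step c at ha
  change 0 ≤ P.step d at hb
  change 0 ≤ P.step c * P.step d
  rw [P.step_nonneg] at ha hb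
  rw [P.step_mul, P.step_nonneg]
  exact mul_nonneg ha hb

theorem exists_eq_sub (g : P.R) : ∃ a b : P.R, 0 ≤ a ∧ 0 ≤ b ∧ g = a - b := by
  obtain ⟨g, hg⟩ := g
  obtain ⟨c, rfl⟩ := P.mem_R.1 hg
  refine ⟨⟨P.step |c|, P.step_mem_R _⟩, ⟨P.step (|c| - c), P.step_mem_R _⟩, ?_, ?_, ?_⟩
  · exact P.step_nonneg.2 (abs_nonneg c)
  · exact P.step_nonneg.2 (sub_nonneg.2 (le_abs_self c))
  · rw [eq_sub_iff_add_eq]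
    apply Subtype.ext
    change P.step c + P.step (|c| - c) = P.step |c|
    rw [P.step_add]
    congr 1
    abel

/-- The `T`-strong dual of `L^∞(T)`: all maps `L^∞(T) → R(T)` that are `R(T)`-linear, regular
and `‖·‖_{T,∞}`-bounded, with pointwise operations. -/
def Dual : Submodule P.R (P.Linf →ₗ[P.R] P.R) where
  carrier := {φ | P.IsRegular φ ∧ (P.boundSet φ).Nonempty}
  add_mem' := fun {φ ψ} hφ hψ => by
    obtain ⟨⟨φ₁, φ₂, h1, h2, h3⟩, g, hg, hφg⟩ := hφ
    obtain ⟨⟨ψ₁, ψ₂, k1, k2, k3⟩, g', hg', hψg⟩ := hψ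
    refine ⟨⟨φ₁ + ψ₁, φ₂ + ψ₂, fun f hf => P.add_nonneg_R (h1 f hf) (k1 f hf),
      fun f hf => P.add_nonneg_R (h2 f hf) (k2 f hf), fun f => ?_⟩, g + g',
      P.add_nonneg_R hg hg', fun f => ?_⟩
    · rw [LinearMap.add_apply, h3, k3, LinearMap.add_apply, LinearMap.add_apply]
      abel
    · obtain ⟨a, ha⟩ := P.mem_R.1 (φ f).2
      obtain ⟨b, hb⟩ := P.mem_R.1 (ψ f).2
      obtain ⟨c, hc⟩ := P.mem_R.1 (g * P.normInf f).2
      obtain ⟨d, hd⟩ := P.mem_R.1 (g' * P.normInf f).2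
      have e1 := hφg f
      have e2 := hψg f
      rw [add_mul]
      change |(φ f : Ω →ₘ[μ] ℝ) + ψ f| ≤
        ((g * P.normInf f : P.R) : Ω →ₘ[μ] ℝ) + ((g' * P.normInf f : P.R) : Ω →ₘ[μ] ℝ)
      rw [ha, hc, P.step_abs, P.step_le_step] at e1
      rw [hb, hd, P.step_abs, P.step_le_step] at e2
      rw [ha, hb, hc, hd, P.step_add, P.step_add, P.step_abs, P.step_le_step]
      exact fun i => (abs_add_le _ _).trans (add_le_add (e1 i) (e2 i))
  zero_mem' := ⟨⟨0, 0, fun _ _ => le_rfl, fun _ _ => le_rfl, fun _ => by simp⟩, 0, le_rfl,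
    fun f => by
      rw [zero_mul]
      change |(0 : Ω →ₘ[μ] ℝ)| ≤ 0
      rw [abs_zero]⟩
  smul_mem' := fun r φ hφ => by
    obtain ⟨⟨φ₁, φ₂, h1, h2, h3⟩, g, hg, hφg⟩ := hφ
    obtain ⟨a, b, ha, hb, rfl⟩ := P.exists_eq_sub r
    have hm : ∀ (a : P.R) (φ : P.Linf →ₗ[ℝ] P.R), ∃ ψ : P.Linf →ₗ[ℝ] P.R,
        ∀ f, ψ f = a * φ f := fun a φ => ⟨(LinearMap.mulLeft ℝ a).comp φ, fun _ => rfl⟩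
    obtain ⟨p1, hp1⟩ := hm a φ₁
    obtain ⟨p2, hp2⟩ := hm b φ₂
    obtain ⟨p3, hp3⟩ := hm a φ₂
    obtain ⟨p4, hp4⟩ := hm b φ₁
    refine ⟨⟨p1 + p2, p3 + p4, fun f hf => ?_, fun f hf => ?_, fun f => ?_⟩,
      (a + b) * g, P.mul_nonneg_R (P.add_nonneg_R ha hb) hg, fun f => ?_⟩
    · rw [LinearMap.add_apply, hp1, hp2]
      exact P.add_nonneg_R (P.mul_nonneg_R ha (h1 f hf)) (P.mul_nonneg_R hb (h2 f hf))
    · rw [LinearMap.add_apply, hp3, hp4]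
      exact P.add_nonneg_R (P.mul_nonneg_R ha (h2 f hf)) (P.mul_nonneg_R hb (h1 f hf))
    · rw [LinearMap.smul_apply, LinearMap.add_apply, LinearMap.add_apply, hp1, hp2, hp3, hp4,
        h3, smul_eq_mul]
      ring
    · obtain ⟨u, hu⟩ := P.mem_R.1 a.2
      obtain ⟨v, hv⟩ := P.mem_R.1 b.2
      obtain ⟨w, hw⟩ := P.mem_R.1 (φ f).2
      obtain ⟨c, hc⟩ := P.mem_R.1 (g * P.normInf f).2
      have hu0 : 0 ≤ u := P.step_nonneg.1 (hu ▸ ha)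
      have hv0 : 0 ≤ v := P.step_nonneg.1 (hv ▸ hb)
      have e1 := hφg f
      rw [hw, hc, P.step_abs, P.step_le_step] at e1
      rw [mul_assoc]
      have hl : (((a - b) • φ) f : P.R) = (⟨P.step ((u - v) * w), P.step_mem_R _⟩ : P.R) := by
        rw [LinearMap.smul_apply, smul_eq_mul, sub_mul, sub_eq_iff_eq_add]
        apply Subtype.ext
        change (a : Ω →ₘ[μ] ℝ) * φ f = P.step ((u - v) * w) + (b : Ω →ₘ[μ] ℝ) * φ f
        rw [hu, hv, hw, P.step_mul, P.step_mul, P.step_add]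
        congr 1
        ring
      have hr : (((a + b) * (g * P.normInf f) : P.R) : Ω →ₘ[μ] ℝ) = P.step ((u + v) * c) := by
        change ((a : Ω →ₘ[μ] ℝ) + b) * ((g * P.normInf f : P.R) : Ω →ₘ[μ] ℝ) = _
        rw [hu, hv, hc, P.step_add, P.step_mul]
      rw [hl, hr]
      change |P.step ((u - v) * w)| ≤ _
      rw [P.step_abs, P.step_le_step]
      intro i
      have h4 : |u i - v i| ≤ u i + v i :=
        abs_le.2 ⟨by linarith [hu0 i, show (0 : ℝ) ≤ u i from hu0 i],
          by linarith [show (0 : ℝ) ≤ v i from hv0 i]⟩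
      change |(u i - v i) * w i| ≤ (u i + v i) * c i
      rw [abs_mul]
      exact mul_le_mul h4 (e1 i) (abs_nonneg _) ((abs_nonneg _).trans h4)

instance instModuleDual : Module P.R P.Dual := Submodule.module P.Dual

instance instSMulDual : SMul P.R P.Dual := P.instModuleDual.toSMul

theorem exists_isGLB_boundSet (φ : P.Dual) : ∃ g, IsGLB (P.boundSet φ.1) g :=
  P.exists_isGLB _ φ.2.2 ⟨0, fun _ ha => ha.1⟩

/-- `‖φ‖ = inf {g ∈ R(T)₊ | ∀ f ∈ L^∞(T), |φ f| ≤ g ‖f‖_{T,∞}}`, the `R(T)`-valued norm on the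
`T`-strong dual; the infimum is taken in `R(T)`. -/
def dualNorm (φ : P.Dual) : P.R := (P.exists_isGLB_boundSet φ).choose

theorem isGLB_dualNorm (φ : P.Dual) : IsGLB (P.boundSet φ.1) (P.dualNorm φ) :=
  (P.exists_isGLB_boundSet φ).choose_spec

theorem exists_sub_nonneg (f : P.Linf) : ∃ f₁ f₂ : P.Linf, 0 ≤ f₁ ∧ 0 ≤ f₂ ∧ f = f₁ - f₂ := by
  obtain ⟨hf, g, hg, hg0, hfg⟩ := f.2
  obtain ⟨c, rfl⟩ := P.mem_R.1 hg
  have hgL : P.step c ∈ P.Linf := by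
    refine ⟨P.step_mem_L1 c, P.step c, hg, hg0, ?_⟩
    rw [P.step_abs, abs_of_nonneg (P.step_nonneg.1 hg0)]
  refine ⟨⟨P.step c, hgL⟩, ⟨P.step c, hgL⟩ - f, hg0, ?_, by abel⟩
  change (0 : Ω →ₘ[μ] ℝ) ≤ P.step c - f.1
  rw [P.le_iff_ae] at hfg ⊢
  intro i
  filter_upwards [hfg i, P.restrict_of_ae (AEEqFun.coeFn_sub (P.step c) f.1) i,
    P.restrict_of_ae (AEEqFun.coeFn_abs f.1) i,
    P.restrict_of_ae (AEEqFun.coeFn_zero (μ := μ) (β := ℝ)) i] with ω h1 h2 h3 h4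
  rw [h2, h4, Pi.sub_apply, Pi.zero_apply]
  rw [h3] at h1
  linarith [le_abs_self (f.1 ω)]

/-- The order of the `T`-strong dual: `φ ≤ ψ` iff `ψ - φ` is a positive operator. -/
instance instPartialOrderDual : PartialOrder P.Dual where
  le φ ψ := ∀ f : P.Linf, 0 ≤ f → φ.1 f ≤ ψ.1 f
  le_refl _ _ _ := le_rfl
  le_trans _ _ _ h h' f hf := (h f hf).trans (h' f hf)
  le_antisymm φ ψ h h' := by
    apply Subtype.ext
    apply LinearMap.ext
    intro f
    obtain ⟨f₁, f₂, h1, h2, rfl⟩ := P.exists_sub_nonneg f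
    rw [map_sub, map_sub, le_antisymm (h f₁ h1) (h' f₁ h1), le_antisymm (h f₂ h2) (h' f₂ h2)]

/-! ### The cells `Ω_i`, restriction and extension by zero -/

/-- The operator `T_i f = ((1 / μ(Ω_i)) ∫_{Ω_i} f dμ) • 1_{Ω_i}` on the measure space `Ω_i` (with
the restricted σ-algebra and measure) is the conditional expectation of the partition of `Ω_i`
into a single cell. -/
def piece (i : ι) : FinPartition (μ.comap (Subtype.val : P.cell i → Ω)) Unit where
  cell _ := Set.univ
  measurableSet_cell _ := MeasurableSet.univ
  disjoint _ _ h := (h rfl).elim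
  iUnion_cell := Set.iUnion_const _
  pos _ := by
    rw [comap_subtype_coe_apply (P.measurableSet_cell i), Subtype.coe_image_univ]
    exact P.pos i
  lt_top _ := by
    rw [comap_subtype_coe_apply (P.measurableSet_cell i), Subtype.coe_image_univ]
    exact P.lt_top i

theorem quasiMeasurePreserving_val (i : ι) : Measure.QuasiMeasurePreserving
    (Subtype.val : P.cell i → Ω) (μ.comap (Subtype.val : P.cell i → Ω)) μ :=
  ⟨measurable_subtype_coe, by
    rw [map_comap_subtype_coe (P.measurableSet_cell i)]
    exact Measure.absolutelyContinuous_of_le Measure.restrict_le_self⟩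

/-- The restriction `f|_{Ω_i}`. -/
def restr (i : ι) (f : Ω →ₘ[μ] ℝ) : P.cell i →ₘ[μ.comap (Subtype.val : P.cell i → Ω)] ℝ :=
  f.compQuasiMeasurePreserving Subtype.val (P.quasiMeasurePreserving_val i)

open Classical in
/-- The extension by zero of a function on `Ω_i`. -/
def extFun (i : ι) (f : P.cell i → ℝ) (ω : Ω) : ℝ :=
  if h : ω ∈ P.cell i then f ⟨ω, h⟩ else 0

theorem measurable_extFun (i : ι) {f : P.cell i → ℝ} (hf : Measurable f) :
    Measurable (P.extFun i f) := by
  classical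
  unfold extFun
  exact Measurable.dite hf (g := fun _ => (0 : ℝ)) measurable_const (P.measurableSet_cell i)

/-- The extension by zero of (the class of) a function on `Ω_i`. -/
def ext (i : ι) (f : P.cell i →ₘ[μ.comap (Subtype.val : P.cell i → Ω)] ℝ) : Ω →ₘ[μ] ℝ :=
  AEEqFun.mk (P.extFun i f)
    (P.measurable_extFun i f.stronglyMeasurable.measurable).aestronglyMeasurable

/-- The sum `∑ i, ext i (f i)` of the extensions by zero, taken pointwise a.e. -/
def glue (f : ∀ i, P.cell i →ₘ[μ.comap (Subtype.val : P.cell i → Ω)] ℝ) : Ω →ₘ[μ] ℝ :=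
  AEEqFun.mk (fun ω => ∑' i, P.extFun i (f i) ω)
    (Measurable.tsum fun i =>
      P.measurable_extFun i (f i).stronglyMeasurable.measurable).aestronglyMeasurable

theorem restr_ae (i : ι) (f : Ω →ₘ[μ] ℝ) :
    ∀ᵐ ω ∂(μ.comap (Subtype.val : P.cell i → Ω)), P.restr i f ω = f ω :=
  AEEqFun.coeFn_compQuasiMeasurePreserving f (P.quasiMeasurePreserving_val i)

theorem ae_val {i : ι} {p : P.cell i → Prop} :
    (∀ᵐ ω ∂(μ.comap (Subtype.val : P.cell i → Ω)), p ω) ↔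
      ∀ᵐ ω ∂(μ.restrict (P.cell i)), ∀ h : ω ∈ P.cell i, p ⟨ω, h⟩ := by
  rw [ae_restrict_iff_subtype (P.measurableSet_cell i)]
  exact ⟨fun h => h.mono fun ω hω _ => hω, fun h => h.mono fun ω hω => hω ω.2⟩

theorem coeFn_glue (f : ∀ i, P.cell i →ₘ[μ.comap (Subtype.val : P.cell i → Ω)] ℝ) :
    ∀ᵐ ω ∂μ, P.glue f ω = ∑' i, P.extFun i (f i) ω :=
  AEEqFun.coeFn_mk _ _

theorem glue_ae (f : ∀ i, P.cell i →ₘ[μ.comap (Subtype.val : P.cell i → Ω)] ℝ) (i : ι) :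
    ∀ᵐ ω ∂(μ.restrict (P.cell i)), ∀ h : ω ∈ P.cell i, P.glue f ω = f i ⟨ω, h⟩ := by
  filter_upwards [P.restrict_of_ae (P.coeFn_glue f) i] with ω h1 h
  rw [h1, tsum_eq_single i, extFun, dif_pos h]
  intro j hj
  exact dif_neg (fun hj' => (P.disjoint j i hj).notMem_of_mem_left hj' h)

theorem ext_ae (i : ι) (f : P.cell i →ₘ[μ.comap (Subtype.val : P.cell i → Ω)] ℝ) :
    ∀ᵐ ω ∂μ, P.ext i f ω = P.extFun i f ω := AEEqFun.coeFn_mk _ _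

theorem restr_eq (i : ι) {f : Ω →ₘ[μ] ℝ}
    {g : P.cell i →ₘ[μ.comap (Subtype.val : P.cell i → Ω)] ℝ}
    (h : ∀ᵐ ω ∂(μ.restrict (P.cell i)), ∀ h : ω ∈ P.cell i, f ω = g ⟨ω, h⟩) :
    P.restr i f = g := by
  apply AEEqFun.ext
  filter_upwards [P.restr_ae i f, (P.ae_val (p := fun ω => f ω = g ω)).2 h] with ω h1 h2
  rw [h1, h2]

theorem piece_ae {i : ι} {p : P.cell i → Prop} :
    (∀ᵐ ω ∂((μ.comap (Subtype.val : P.cell i → Ω)).restrict ((P.piece i).cell ())), p ω) ↔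
      ∀ᵐ ω ∂(μ.comap (Subtype.val : P.cell i → Ω)), p ω := by
  change (∀ᵐ ω ∂((μ.comap (Subtype.val : P.cell i → Ω)).restrict Set.univ), p ω) ↔ _
  rw [Measure.restrict_univ]

theorem restr_step (i : ι) (c : ι → ℝ) : P.restr i (P.step c) = (P.piece i).step fun _ => c i :=
  (P.piece i).eq_step fun _ => P.piece_ae.2 <| by
    filter_upwards [P.restr_ae i (P.step c),
      (ae_restrict_iff_subtype (P.measurableSet_cell i)).1 (P.step_ae c i)] with ω h1 h2
    rw [h1, h2]

theorem glue_step (c : ∀ _ : ι, Unit → ℝ) :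
    P.glue (fun i => (P.piece i).step (c i)) = P.step fun i => c i () :=
  P.eq_step fun i => by
    filter_upwards [P.glue_ae (fun i => (P.piece i).step (c i)) i, P.ae_mem i,
      P.ae_val.1 (P.piece_ae.1 ((P.piece i).step_ae (c i) ()))] with ω h1 h2 h3
    rw [h1 h2, h3 h2]

/-- The restriction `R(T) → R(T_i)`. -/
def restrR (i : ι) : P.R →+* (P.piece i).R where
  toFun g := ⟨P.restr i g, by
    obtain ⟨c, hc⟩ := P.mem_R.1 g.2
    rw [hc, P.restr_step]
    exact (P.piece i).step_mem_R _⟩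
  map_one' := Subtype.ext <| by
    change P.restr i 1 = 1
    rw [← P.step_one, P.restr_step, ← (P.piece i).step_one]; rfl
  map_mul' g h := Subtype.ext <| by
    obtain ⟨c, hc⟩ := P.mem_R.1 g.2
    obtain ⟨d, hd⟩ := P.mem_R.1 h.2
    change P.restr i (g.1 * h.1) = P.restr i g.1 * P.restr i h.1
    rw [hc, hd, P.step_mul, P.restr_step, P.restr_step, P.restr_step, (P.piece i).step_mul]; rfl
  map_zero' := Subtype.ext <| by
    change P.restr i 0 = 0
    rw [← P.step_zero, P.restr_step, ← (P.piece i).step_zero]; rfl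
  map_add' g h := Subtype.ext <| by
    obtain ⟨c, hc⟩ := P.mem_R.1 g.2
    obtain ⟨d, hd⟩ := P.mem_R.1 h.2
    change P.restr i (g.1 + h.1) = P.restr i g.1 + P.restr i h.1
    rw [hc, hd, P.step_add, P.restr_step, P.restr_step, P.restr_step, (P.piece i).step_add]; rfl

/-- The element `∑ i, ext i (g i)` of `R(T)`, for `g i ∈ R(T_i)`. -/
def glueR (g : ∀ i, (P.piece i).R) : P.R :=
  ⟨P.glue fun i => (g i).1, by
    choose c hc using fun i => (P.piece i).mem_R.1 (g i).2
    simp only [hc]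
    rw [P.glue_step]
    exact P.step_mem_R _⟩

/-- The restriction `L^∞(T) → L^∞(T_i)`. -/
def restrLinf (i : ι) (f : P.Linf) : (P.piece i).Linf :=
  ⟨P.restr i f, by
    obtain ⟨hf, g, hg, hg0, hfg⟩ := f.2
    obtain ⟨c, rfl⟩ := P.mem_R.1 hg
    refine ⟨fun _ => ?_, (P.piece i).step fun _ => c i, (P.piece i).step_mem_R _, ?_, ?_⟩
    · change Integrable _ ((μ.comap (Subtype.val : P.cell i → Ω)).restrict Set.univ)
      rw [Measure.restrict_univ]
      refine Integrable.congr ?_ (Filter.EventuallyEq.symm (P.restr_ae i f.1))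
      have h := hf i
      rw [IntegrableOn, ← map_comap_subtype_coe (P.measurableSet_cell i),
        (MeasurableEmbedding.subtype_coe (P.measurableSet_cell i)).integrable_map_iff] at h
      exact h
    · exact (P.piece i).step_nonneg.2 fun _ => P.step_nonneg.1 hg0 i
    · rw [(P.piece i).le_iff_ae]
      rw [P.le_iff_ae] at hfg
      intro u
      refine P.piece_ae.2 ?_
      filter_upwards [P.restr_ae i f.1, AEEqFun.coeFn_abs (P.restr i f.1),
        P.piece_ae.1 ((P.piece i).step_ae (fun _ => c i) ()),
        (P.ae_val (p := fun ω => |f.1| ω.1 ≤ P.step c ω.1)).2 ((hfg i).mono fun _ h _ => h),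
        (P.ae_val (p := fun ω => P.step c ω.1 = c i)).2 ((P.step_ae c i).mono fun _ h _ => h),
        (P.ae_val (p := fun ω => |f.1| ω.1 = |f.1 ω.1|)).2
          ((P.restrict_of_ae (AEEqFun.coeFn_abs f.1) i).mono fun _ h _ => h)]
        with ω h1 h2 h3 h4 h5 h6
      rw [h2, h1, h3]
      rw [h6, h5] at h4
      exact h4⟩

/-- The extension by zero `L^∞(T_i) → L^∞(T)`. -/
def extLinf (i : ι) (f : (P.piece i).Linf) : P.Linf :=
  ⟨P.ext i f, by
    classical
    obtain ⟨hf, g, hg, hg0, hfg⟩ := f.2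
    obtain ⟨c, rfl⟩ := (P.piece i).mem_R.1 hg
    have hc : 0 ≤ c () := (P.piece i).step_nonneg.1 hg0 ()
    rw [(P.piece i).le_iff_ae] at hfg
    have key : ∀ j, ∀ᵐ ω ∂(μ.restrict (P.cell j)),
        |P.ext i f.1 ω| ≤ (if j = i then c () else 0) := by
      intro j
      by_cases hj : j = i
      · subst hj
        rw [if_pos rfl]
        filter_upwards [P.ae_mem j, P.restrict_of_ae (P.ext_ae j f.1) j,
          P.ae_val.1 (P.piece_ae.1 (hfg ())),
          P.ae_val.1 (P.piece_ae.1 ((P.piece j).step_ae c ())),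
          P.ae_val.1 (AEEqFun.coeFn_abs f.1)] with ω h1 h2 h3 h4 h5
        have h3 := h3 h1
        rw [h5 h1, h4 h1] at h3
        rw [h2, extFun, dif_pos h1]
        exact h3
      · rw [if_neg hj]
        filter_upwards [P.ae_mem j, P.restrict_of_ae (P.ext_ae i f.1) j] with ω h1 h2
        rw [h2, extFun, dif_neg, abs_zero]
        exact fun hi => (P.disjoint j i hj).notMem_of_mem_left h1 hi
    refine ⟨fun j => ?_, P.step fun j => if j = i then c () else 0, P.step_mem_R _, ?_, ?_⟩
    · have := P.finite_restrict j
      exact Integrable.of_bound (AEEqFun.aestronglyMeasurable _).restrict _ (key j)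
    · refine P.step_nonneg.2 fun j => ?_
      change (0 : ℝ) ≤ if j = i then c () else 0
      split_ifs
      · exact hc
      · exact le_rfl
    · rw [P.le_iff_ae]
      intro j
      filter_upwards [key j, P.step_ae (fun j => if j = i then c () else 0) j,
        P.restrict_of_ae (AEEqFun.coeFn_abs (P.ext i f.1)) j] with ω h1 h2 h3
      rw [h2, h3]
      exact h1⟩

/-! ### The product of the `T_i`-strong duals -/

/-- `R(T)` acts on the `T_i`-strong dual of `L^∞(T_i)` by `g • φ = g|_{Ω_i} • φ`. -/
instance instModuleDualPiece (i : ι) : Module P.R (P.piece i).Dual :=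
  Module.compHom _ (P.restrR i)

instance instSMulDualPiece (i : ι) : SMul P.R (P.piece i).Dual :=
  (P.instModuleDualPiece i).toSMul

/-- The product `∏ i, (T_i-strong dual of L^∞(T_i))`, with the coordinatewise order and the
coordinatewise `R(T)`-module structure. -/
abbrev ProdDual : Type _ := ∀ i, (P.piece i).Dual

instance instModuleProdDual : Module P.R P.ProdDual := Pi.module _ _ _

instance instSMulProdDual : SMul P.R P.ProdDual := P.instModuleProdDual.toSMul

/-- The `R(T)`-valued norm `‖(φ_i)_i‖ = ∑ i, ext i ‖φ_i‖` on the product. -/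
def prodNorm (φ : P.ProdDual) : P.R := P.glueR fun i => (P.piece i).dualNorm (φ i)

end Basic

end FinPartition

/-- Every two elements have a supremum. -/
def HasBinarySups (E : Type*) [PartialOrder E] : Prop := ∀ x y : E, ∃ z, IsLUB {x, y} z

/-- The map preserves suprema of two elements: `Φ (x ⊔ y) = Φ x ⊔ Φ y`. -/
def PreservesBinarySups {E F : Type*} [PartialOrder E] [PartialOrder F] (Φ : E → F) : Prop :=
  ∀ x y z : E, IsLUB {x, y} z → IsLUB {Φ x, Φ y} (Φ z)

end StrongDual

end

noncomputable section

namespace StrongDual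

/-! Taking values on the cells identifies `R(T)` with `ℝ^I` as an ordered algebra (`coord`), and
every notion in the theorem then splits over the cells. The sets whose infima define the two
`R(T)`-valued norms are products of closed subsets of `ℝ`, so both infima are attained cell by cell:
the `i`-th value of `‖f‖_{T,∞}` is the essential supremum of `|f|` on `Ω_i`, and the `i`-th value of
`‖φ‖` is the least admissible constant on `Ω_i` (`coord_normInf_le`, `coord_dualNorm_le`).

An element of the `T`-strong dual thus becomes a family of real functionals `L i` with `|L i f| ≤ M
i * ess sup_{Ω_i} |f|`. Such an `L i` is local: it sees only the restriction of `f` to `Ω_i`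
(`functional_eq_of_ae`). Conversely, every family of this kind comes from the dual (`dualOf`):
`R(T)`-linearity is real linearity plus locality, since `a f` and `a_i f` agree on `Ω_i`, and
regularity comes from the positive parts given by the Riesz–Kantorovich formula
(`exists_isLUB_image_Icc`, `exists_posPart`).

By locality, composing with restriction to `Ω_i` and with extension by zero gives mutually inverse
maps. Both operations keep positivity and the norm on the cell, whence the isometry and the order
isomorphism. Suprema exist in the dual as `ψ + (φ - ψ)⁺`, formed cellwise, and in the product
coordinatewise. -/

/-! ### Positive parts of real functionals -/

/-- The Riesz–Kantorovich formula for real functionals on an ordered vector space with the Riesz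
decomposition property. -/
theorem exists_isLUB_image_Icc {E : Type*} [AddCommGroup E] [PartialOrder E]
    [IsOrderedAddMonoid E] [Module ℝ E]
    (hsmul : ∀ (r : ℝ) (f : E), 0 ≤ r → 0 ≤ f → 0 ≤ r • f)
    (hgen : ∀ f : E, ∃ a b : E, 0 ≤ a ∧ 0 ≤ b ∧ f = a - b)
    (hdec : ∀ h f g : E, 0 ≤ f → 0 ≤ g → 0 ≤ h → h ≤ f + g →
      ∃ a b : E, a ∈ Set.Icc 0 f ∧ b ∈ Set.Icc 0 g ∧ h = a + b)
    (L : E →ₗ[ℝ] ℝ) (hL : ∀ f, 0 ≤ f → BddAbove (L '' Set.Icc 0 f)) :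
    ∃ K : E →ₗ[ℝ] ℝ, ∀ f, 0 ≤ f → IsLUB (L '' Set.Icc 0 f) (K f) := by
  -- The supremum `p` is meaningful on the positive cone only; elsewhere it gets the unused value
  -- `0`.
  have hp : ∀ f : E, ∃ x : ℝ, 0 ≤ f → IsLUB (L '' Set.Icc 0 f) x := by
    intro f
    by_cases h : 0 ≤ f
    · have hne : (L '' Set.Icc 0 f).Nonempty := ⟨L 0, 0, ⟨le_rfl, h⟩, rfl⟩
      exact (Real.exists_isLUB hne (hL f h)).imp fun _ hx _ => hx
    · exact ⟨0, fun h' => (h h').elim⟩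
  choose p hp using hp
  have hadd : ∀ f g, 0 ≤ f → 0 ≤ g → p (f + g) = p f + p g := by
    intro f g hf hg
    apply le_antisymm
    · refine (hp _ (add_nonneg hf hg)).2 ?_
      rintro _ ⟨h, ⟨h0, h1⟩, rfl⟩
      obtain ⟨a, b, ha, hb, rfl⟩ := hdec h f g hf hg h0 h1
      rw [map_add]
      exact add_le_add ((hp f hf).1 ⟨a, ha, rfl⟩) ((hp g hg).1 ⟨b, hb, rfl⟩)
    · rw [← le_sub_iff_add_le]
      refine (hp f hf).2 ?_
      rintro _ ⟨a, ha, rfl⟩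
      rw [le_sub_comm]
      refine (hp g hg).2 ?_
      rintro _ ⟨b, hb, rfl⟩
      rw [le_sub_iff_add_le, ← map_add]
      exact (hp _ (add_nonneg hf hg)).1
        ⟨b + a, ⟨add_nonneg hb.1 ha.1, by rw [add_comm f]; exact add_le_add hb.2 ha.2⟩, rfl⟩
  -- One inequality suffices: the other one is this applied to `r⁻¹` and `r • f`.
  have hmul_le : ∀ (r : ℝ) f, 0 < r → 0 ≤ f → p (r • f) ≤ r * p f := by
    intro r f hr hf
    refine (hp _ (hsmul r f hr.le hf)).2 ?_
    rintro _ ⟨g, ⟨hg0, hg1⟩, rfl⟩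
    have h2 : r⁻¹ • g ≤ f := by
      have := hsmul r⁻¹ _ (inv_pos.2 hr).le (sub_nonneg.2 hg1)
      rwa [smul_sub, smul_smul, inv_mul_cancel₀ hr.ne', one_smul, sub_nonneg] at this
    have h1 := (hp f hf).1 ⟨r⁻¹ • g, ⟨hsmul _ _ (inv_pos.2 hr).le hg0, h2⟩, rfl⟩
    rw [map_smul, smul_eq_mul, inv_mul_le_iff₀ hr] at h1
    exact h1
  have hmul : ∀ (r : ℝ) f, 0 ≤ r → 0 ≤ f → p (r • f) = r * p f := by
    intro r f hr hf
    obtain rfl | hr := hr.eq_or_lt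
    · have := hadd 0 0 le_rfl le_rfl
      rw [add_zero] at this
      rw [zero_smul, zero_mul]
      linarith
    · refine le_antisymm (hmul_le r f hr hf) ?_
      have := hmul_le r⁻¹ (r • f) (inv_pos.2 hr) (hsmul r f hr.le hf)
      rwa [smul_smul, inv_mul_cancel₀ hr.ne', one_smul, le_inv_mul_iff₀ hr] at this
  choose a b ha hb hab using hgen
  -- By additivity of `p` on the cone, `p c - p d` depends only on `c - d`, so any convenient
  -- decomposition may be used to compute the extension of `p`.
  have hwd : ∀ f c d : E, 0 ≤ c → 0 ≤ d → f = c - d → p (a f) - p (b f) = p c - p d := by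
    intro f c d hc hd h
    have h1 : a f + d = c + b f := by
      rw [hab f] at h
      exact sub_eq_sub_iff_add_eq_add.1 h
    have h2 := hadd (a f) d (ha f) hd
    rw [h1, hadd c (b f) hc (hb f)] at h2
    linarith
  refine ⟨{ toFun := fun f => p (a f) - p (b f), map_add' := ?_, map_smul' := ?_ }, ?_⟩
  · intro f g
    rw [hwd (f + g) (a f + a g) (b f + b g) (add_nonneg (ha f) (ha g))
      (add_nonneg (hb f) (hb g)), hadd _ _ (ha f) (ha g), hadd _ _ (hb f) (hb g)]
    · ring
    · conv_lhs => rw [hab f, hab g]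
      abel
  · intro r f
    rw [RingHom.id_apply, smul_eq_mul]
    obtain hr | hr := le_total 0 r
    · rw [hwd (r • f) (r • a f) (r • b f) (hsmul _ _ hr (ha f)) (hsmul _ _ hr (hb f)),
        hmul _ _ hr (ha f), hmul _ _ hr (hb f)]
      · ring
      · rw [← smul_sub, ← hab f]
    -- A negative scalar exchanges the two parts of the decomposition.
    · have hr' : 0 ≤ -r := neg_nonneg.2 hr
      rw [hwd (r • f) ((-r) • b f) ((-r) • a f) (hsmul _ _ hr' (hb f)) (hsmul _ _ hr' (ha f)),
        hmul _ _ hr' (ha f), hmul _ _ hr' (hb f)]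
      · ring
      · rw [← smul_sub, neg_smul, ← smul_neg, neg_sub, ← hab f]
  · intro f hf
    have h0 : p 0 = 0 := by simpa using hmul 0 0 le_rfl le_rfl
    change IsLUB _ (p (a f) - p (b f))
    rw [hwd f f 0 hf le_rfl (sub_zero f).symm, h0, sub_zero]
    exact hp f hf

namespace FinPartition

/-! ### Cellwise coordinates on `R(T)` and for the norms -/

section Coordinates

universe u v

variable {Ω : Type u} [MeasurableSpace Ω] {μ : Measure Ω} {ι : Type v} [Countable ι]
  (P : FinPartition μ ι)

theorem step_injective : Function.Injective P.step := fun _ _ h =>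
  le_antisymm (P.step_le_step.1 h.le) (P.step_le_step.1 h.ge)

/-- The algebra homomorphism `c ↦ ∑ i, c i • 1_{Ω_i}`. -/
def stepHom : (ι → ℝ) →ₐ[ℝ] P.R where
  toFun c := ⟨P.step c, P.step_mem_R c⟩
  map_one' := Subtype.ext P.step_one
  map_mul' c d := Subtype.ext (P.step_mul c d).symm
  map_zero' := Subtype.ext P.step_zero
  map_add' c d := Subtype.ext (P.step_add c d).symm
  commutes' r := Subtype.ext <| by
    change P.step (algebraMap ℝ (ι → ℝ) r) = algebraMap ℝ (Ω →ₘ[μ] ℝ) r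
    rw [Algebra.algebraMap_eq_smul_one, Algebra.algebraMap_eq_smul_one, ← P.step_one,
      P.step_smul]

theorem stepHom_bijective : Function.Bijective P.stepHom := by
  refine ⟨fun c d h => P.step_injective (congrArg Subtype.val h), fun a => ?_⟩
  obtain ⟨c, hc⟩ := P.mem_R.1 a.2
  exact ⟨c, Subtype.ext hc.symm⟩

/-- The values of an element of `R(T)` on the cells. -/
def coord : P.R ≃ₐ[ℝ] (ι → ℝ) := (AlgEquiv.ofBijective P.stepHom P.stepHom_bijective).symm

theorem step_coord (a : P.R) : P.step (P.coord a) = a :=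
  congrArg Subtype.val ((AlgEquiv.ofBijective P.stepHom P.stepHom_bijective).apply_symm_apply a)

theorem coord_eq {a : P.R} {c : ι → ℝ} (h : (a : Ω →ₘ[μ] ℝ) = P.step c) : P.coord a = c :=
  P.step_injective ((P.step_coord a).trans h)

theorem coord_le {a b : P.R} : P.coord a ≤ P.coord b ↔ a ≤ b := by
  rw [← P.step_le_step, P.step_coord, P.step_coord]
  rfl

theorem coord_nonneg {a : P.R} : 0 ≤ P.coord a ↔ 0 ≤ a := by
  rw [← P.coord_le, map_zero]

theorem coord_ext {a b : P.R} (h : ∀ i, P.coord a i = P.coord b i) : a = b :=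
  P.coord.injective (funext h)

theorem abs_le_iff_coord {a b : P.R} :
    |(a : Ω →ₘ[μ] ℝ)| ≤ b ↔ ∀ i, |P.coord a i| ≤ P.coord b i := by
  rw [← P.step_coord a, ← P.step_coord b, P.step_abs, P.step_le_step]
  rfl

/-- In coordinates `S` is the product of the sets `U i`, and infima in a product are coordinatewise.
The proof changes one coordinate at a time; a member of `S` is needed to fill the remaining ones. -/
theorem isGLB_coord {S : Set P.R} {a : P.R} (hS : IsGLB S a) (hne : S.Nonempty)
    (U : ι → Set ℝ) (hU : ∀ g, g ∈ S ↔ ∀ i, P.coord g i ∈ U i) (i : ι) :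
    IsGLB (U i) (P.coord a i) := by
  classical
  obtain ⟨g, hg⟩ := hne
  constructor
  · intro x hx
    have h : P.coord.symm (Function.update (P.coord g) i x) ∈ S := by
      rw [hU]
      intro j
      rw [AlgEquiv.apply_symm_apply]
      by_cases hj : j = i
      · subst hj; rwa [Function.update_self]
      · rw [Function.update_of_ne hj]; exact (hU g).1 hg j
    have h' := P.coord_le.2 (hS.1 h) i
    rwa [AlgEquiv.apply_symm_apply, Function.update_self] at h'
  · intro x hx
    have h : P.coord.symm (Function.update (P.coord a) i x) ∈ lowerBounds S := by
      intro b hb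
      rw [← P.coord_le, AlgEquiv.apply_symm_apply, update_le_iff]
      exact ⟨hx ((hU b).1 hb i), fun j _ => P.coord_le.2 (hS.1 hb) j⟩
    have h' := P.coord_le.2 (hS.2 h) i
    rwa [AlgEquiv.apply_symm_apply, Function.update_self] at h'

/-- For a convergent sequence of bounds, the countably many null sets can be discarded together.
Closedness is what makes the essential supremum itself a bound. -/
theorem isClosed_setOf_ae_abs_le (ν : Measure Ω) (f : Ω → ℝ) :
    IsClosed {x : ℝ | ∀ᵐ ω ∂ν, |f ω| ≤ x} := by
  refine IsSeqClosed.isClosed fun x y hx hxy => ?_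
  filter_upwards [ae_all_iff.2 hx] with ω hω
  exact ge_of_tendsto' hxy hω

theorem ae_abs_coe (f : Ω →ₘ[μ] ℝ) (c : ι → ℝ) :
    |f| ≤ P.step c ↔ ∀ i, ∀ᵐ ω ∂(μ.restrict (P.cell i)), |f ω| ≤ c i := by
  rw [P.le_iff_ae]
  refine forall_congr' fun i => Filter.eventually_congr ?_
  filter_upwards [P.step_ae c i, P.restrict_of_ae (AEEqFun.coeFn_abs f) i] with ω h1 h2
  rw [h1, h2]

theorem nonneg_of_ae_abs_le {i : ι} {f : Ω → ℝ} {x : ℝ}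
    (h : ∀ᵐ ω ∂(μ.restrict (P.cell i)), |f ω| ≤ x) : 0 ≤ x := by
  have := P.neBot_ae_restrict i
  obtain ⟨ω, hω⟩ := h.exists
  exact (abs_nonneg _).trans hω

/-- This identifies the coordinate of `‖f‖_{T,∞}` with the essential supremum of `|f|` on the cell.
The infimum lies in the closed set of bounds, which gives the forward implication. -/
theorem coord_normInf_le {f : P.Linf} {i : ι} {x : ℝ} :
    P.coord (P.normInf f) i ≤ x ↔ ∀ᵐ ω ∂(μ.restrict (P.cell i)), |f.1 ω| ≤ x := by
  obtain ⟨-, g, hg, hg0, hfg⟩ := f.2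
  have key := P.isGLB_coord (P.isGLB_normInf f) ⟨⟨g, hg⟩, hg0, hfg⟩
    (fun i => {x | ∀ᵐ ω ∂(μ.restrict (P.cell i)), |f.1 ω| ≤ x}) (fun a => by
      change 0 ≤ a ∧ |f.1| ≤ a.1 ↔ _
      rw [← P.step_coord a, P.ae_abs_coe]
      -- A cell has positive measure, so a bound for `|f|` on it is automatically nonnegative.
      refine and_iff_right_of_imp fun h => ?_
      rw [← P.coord_nonneg]
      exact fun i => P.nonneg_of_ae_abs_le (h i)) i
  refine ⟨fun h => ?_, fun h => key.1 h⟩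
  have hne : {x : ℝ | ∀ᵐ ω ∂(μ.restrict (P.cell i)), |f.1 ω| ≤ x}.Nonempty := by
    obtain ⟨c, rfl⟩ := P.mem_R.1 hg
    exact ⟨c i, (P.ae_abs_coe _ _).1 hfg i⟩
  have := key.mem_of_isClosed hne (isClosed_setOf_ae_abs_le _ _)
  exact Filter.Eventually.mono this fun ω hω => le_trans hω h

theorem coord_normInf_nonneg (f : P.Linf) (i : ι) : 0 ≤ P.coord (P.normInf f) i :=
  P.coord_nonneg.2 (P.normInf_nonneg f) i

theorem mem_boundSet {φ : P.Linf → P.R} {g : P.R} :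
    g ∈ P.boundSet φ ↔
      ∀ i, 0 ≤ P.coord g i ∧
        ∀ f, |P.coord (φ f) i| ≤ P.coord g i * P.coord (P.normInf f) i := by
  change (0 ≤ g ∧ ∀ f, |(φ f : Ω →ₘ[μ] ℝ)| ≤ ((g * P.normInf f : P.R) : Ω →ₘ[μ] ℝ)) ↔ _
  simp only [P.abs_le_iff_coord, map_mul, Pi.mul_apply, ← P.coord_nonneg (a := g)]
  exact ⟨fun h i => ⟨h.1 i, fun f => h.2 f i⟩, fun h => ⟨fun i => (h i).1, fun f i => (h i).2 f⟩⟩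

/-- The conditions defining `boundSet` are imposed cell by cell and are closed, so the infimum is
attained on each cell separately. -/
theorem coord_dualNorm_le {φ : P.Dual} {i : ι} {x : ℝ} :
    P.coord (P.dualNorm φ) i ≤ x ↔
      0 ≤ x ∧ ∀ f, |P.coord (φ.1 f) i| ≤ x * P.coord (P.normInf f) i := by
  have key := P.isGLB_coord (P.isGLB_dualNorm φ) φ.2.2
    (fun i => {x | 0 ≤ x ∧ ∀ f, |P.coord (φ.1 f) i| ≤ x * P.coord (P.normInf f) i})
    (fun a => P.mem_boundSet) i
  refine ⟨fun h => ?_, fun h => key.1 h⟩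
  obtain ⟨g, hg⟩ := φ.2.2
  have hc : IsClosed {x : ℝ | 0 ≤ x ∧
      ∀ f, |P.coord (φ.1 f) i| ≤ x * P.coord (P.normInf f) i} := by
    rw [Set.ofPred_and, Set.ofPred_forall]
    refine (isClosed_le continuous_const continuous_id).inter ?_
    exact isClosed_iInter fun f =>
      isClosed_le continuous_const (continuous_id.mul continuous_const)
  obtain ⟨h1, h2⟩ := key.mem_of_isClosed ⟨_, P.mem_boundSet.1 hg i⟩ hc
  exact ⟨h1.trans h, fun f => (h2 f).trans
    (mul_le_mul_of_nonneg_right h (P.coord_normInf_nonneg f i))⟩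

theorem abs_coord_apply_le (φ : P.Dual) (f : P.Linf) (i : ι) :
    |P.coord (φ.1 f) i| ≤ P.coord (P.dualNorm φ) i * P.coord (P.normInf f) i :=
  (P.coord_dualNorm_le.1 le_rfl).2 f

theorem coord_dualNorm_nonneg (φ : P.Dual) (i : ι) : 0 ≤ P.coord (P.dualNorm φ) i :=
  (P.coord_dualNorm_le.1 le_rfl).1

/-! ### Order structure of `L^∞(T)` and bounded functionals -/

theorem mem_Linf_of_abs_le {f : Ω →ₘ[μ] ℝ} {c : ι → ℝ} (h : |f| ≤ P.step c) : f ∈ P.Linf := by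
  rw [P.ae_abs_coe] at h
  refine ⟨fun i => ?_, P.step c, P.step_mem_R c,
    P.step_nonneg.2 fun i => P.nonneg_of_ae_abs_le (h i), (P.ae_abs_coe f c).2 h⟩
  have := P.finite_restrict i
  exact Integrable.of_bound (AEEqFun.aestronglyMeasurable _).restrict _ (h i)

theorem smul_Linf_nonneg (r : ℝ) (f : P.Linf) (hr : 0 ≤ r) (hf : 0 ≤ f) : 0 ≤ r • f := by
  change (0 : Ω →ₘ[μ] ℝ) ≤ r • f.1
  change (0 : Ω →ₘ[μ] ℝ) ≤ f.1 at hf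
  rw [← AEEqFun.coeFn_le] at hf ⊢
  filter_upwards [hf, AEEqFun.coeFn_smul r f.1, AEEqFun.coeFn_zero (α := Ω) (μ := μ) (β := ℝ)]
    with ω h1 h2 h3
  rw [h3] at h1 ⊢
  rw [h2]
  exact mul_nonneg hr h1

/-- Riesz decomposition with `a = h ⊓ f`; the remainder `h - h ⊓ f` is at most `g` because both `h -
g ≤ h` and `h - g ≤ f`. -/
theorem exists_add_of_le_add (h f g : P.Linf) (hf : 0 ≤ f) (hg : 0 ≤ g) (hh : 0 ≤ h)
    (hle : h ≤ f + g) :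
    ∃ a b : P.Linf, a ∈ Set.Icc 0 f ∧ b ∈ Set.Icc 0 g ∧ h = a + b := by
  obtain ⟨-, s, hs, -, hfs⟩ := f.2
  obtain ⟨c, rfl⟩ := P.mem_R.1 hs
  have h0 : (0 : Ω →ₘ[μ] ℝ) ≤ h.1 ⊓ f.1 := le_inf hh hf
  have hm : h.1 ⊓ f.1 ∈ P.Linf := P.mem_Linf_of_abs_le (c := c) <| by
    rw [abs_of_nonneg h0]
    exact inf_le_right.trans ((le_abs_self f.1).trans hfs)
  refine ⟨⟨_, hm⟩, h - ⟨_, hm⟩, ⟨h0, inf_le_right (a := h.1)⟩, ⟨?_, ?_⟩, by abel⟩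
  · exact sub_nonneg.2 (inf_le_left (a := h.1))
  · rw [sub_le_comm]
    exact le_inf (sub_le_self h.1 hg) (sub_le_iff_le_add.2 hle)

/-- The element `∑ i, c i • 1_{Ω_i}` of `L^∞(T)`. -/
def stepLinf (c : ι → ℝ) : P.Linf :=
  ⟨P.step c, P.mem_Linf_of_abs_le (P.step_abs c).le⟩

/-- The step function `s` with the values of `‖f‖_{T,∞}` satisfies `-s ≤ f ≤ s` and is no larger
than `f` in norm. Positivity yields `|K f| ≤ K s`, so a bound on the positive cone extends to all
`f`. -/
theorem abs_le_mul_of_nonneg {K : P.Linf →ₗ[ℝ] ℝ} {M : ℝ} {i : ι} (hM : 0 ≤ M)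
    (hK0 : ∀ f, 0 ≤ f → 0 ≤ K f) (hK : ∀ f, 0 ≤ f → K f ≤ M * P.coord (P.normInf f) i)
    (f : P.Linf) : |K f| ≤ M * P.coord (P.normInf f) i := by
  set s := P.stepLinf (P.coord (P.normInf f)) with hs
  have hfs : |f.1| ≤ s.1 := (P.ae_abs_coe _ _).2 fun i => P.coord_normInf_le.1 le_rfl
  have h1 : 0 ≤ s - f := sub_nonneg.2 ((le_abs_self f.1).trans hfs)
  have h2 : 0 ≤ s + f := neg_le_iff_add_nonneg.1 (show -f ≤ s from (neg_le_abs f.1).trans hfs)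
  have h0 : 0 ≤ s := P.step_nonneg.2 fun i => P.coord_normInf_nonneg f i
  have hsn : P.coord (P.normInf s) i ≤ P.coord (P.normInf f) i := by
    rw [P.coord_normInf_le]
    filter_upwards [P.step_ae (P.coord (P.normInf f)) i] with ω h
    exact (abs_of_nonneg (h.symm ▸ P.coord_normInf_nonneg f i)).trans h |>.le
  have h3 := (hK s h0).trans (mul_le_mul_of_nonneg_left hsn hM)
  have h4 := hK0 _ h1
  have h5 := hK0 _ h2
  rw [map_sub] at h4
  rw [map_add] at h5
  exact abs_le.2 ⟨by linarith, by linarith⟩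

theorem coord_normInf_mono {f g : P.Linf} (hf : 0 ≤ f) (h : f ≤ g) (i : ι) :
    P.coord (P.normInf f) i ≤ P.coord (P.normInf g) i := by
  rw [P.coord_normInf_le]
  have hf' : (0 : Ω →ₘ[μ] ℝ) ≤ f.1 := hf
  have h' : f.1 ≤ g.1 := h
  rw [← AEEqFun.coeFn_le] at hf' h'
  filter_upwards [P.coord_normInf_le.1 (le_refl (P.coord (P.normInf g) i)),
    P.restrict_of_ae hf' i, P.restrict_of_ae h' i,
    P.restrict_of_ae (AEEqFun.coeFn_zero (μ := μ) (β := ℝ)) i] with ω h1 h2 h3 h4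
  rw [h4] at h2
  rw [abs_of_nonneg h2]
  exact h3.trans ((le_abs_self _).trans h1)

/-- The positive part of a bounded functional on `L^∞(T)`. -/
theorem exists_posPart (L : P.Linf →ₗ[ℝ] ℝ) {M : ℝ} {i : ι} (hM : 0 ≤ M)
    (hL : ∀ f, |L f| ≤ M * P.coord (P.normInf f) i) :
    ∃ K : P.Linf →ₗ[ℝ] ℝ, (∀ f, 0 ≤ f → IsLUB (L '' Set.Icc 0 f) (K f)) ∧
      ∀ f, |K f| ≤ M * P.coord (P.normInf f) i := by
  have hub : ∀ f, 0 ≤ f → M * P.coord (P.normInf f) i ∈ upperBounds (L '' Set.Icc 0 f) := by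
    rintro f - _ ⟨g, hg, rfl⟩
    exact (le_abs_self _).trans ((hL g).trans
      (mul_le_mul_of_nonneg_left (P.coord_normInf_mono hg.1 hg.2 i) hM))
  obtain ⟨K, hK⟩ := exists_isLUB_image_Icc P.smul_Linf_nonneg P.exists_sub_nonneg
    P.exists_add_of_le_add L fun f hf => ⟨_, hub f hf⟩
  refine ⟨K, hK, P.abs_le_mul_of_nonneg hM (fun f hf => ?_) fun f hf => (hK f hf).2 (hub f hf)⟩
  exact (hK f hf).1 ⟨0, ⟨le_rfl, hf⟩, map_zero L⟩

/-! ### The dual as families of bounded functionals -/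

/-- The map `f ↦ ∑ i, L i f • 1_{Ω_i}` for functionals `L i`. -/
def ofFunctionals (L : ι → P.Linf →ₗ[ℝ] ℝ) : P.Linf →ₗ[ℝ] P.R :=
  P.coord.symm.toLinearMap.comp (LinearMap.pi L)

theorem coord_ofFunctionals (L : ι → P.Linf →ₗ[ℝ] ℝ) (f : P.Linf) (i : ι) :
    P.coord (P.ofFunctionals L f) i = L i f :=
  congrFun (P.coord.apply_symm_apply _) i

/-- Locality: if `f = g` a.e. on `Ω_i`, then `f - g` has norm zero there, and the bound forces `L (f
- g) = 0`. -/
theorem functional_eq_of_ae {L : P.Linf →ₗ[ℝ] ℝ} {M : ℝ} {i : ι} (hM : 0 ≤ M)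
    (hL : ∀ f, |L f| ≤ M * P.coord (P.normInf f) i) {f g : P.Linf}
    (h : ∀ᵐ ω ∂(μ.restrict (P.cell i)), f.1 ω = g.1 ω) : L f = L g := by
  have h0 : P.coord (P.normInf (f - g)) i ≤ 0 := by
    rw [P.coord_normInf_le]
    filter_upwards [h, P.restrict_of_ae (AEEqFun.coeFn_sub f.1 g.1) i] with ω h1 h2
    change |(f.1 - g.1) ω| ≤ 0
    rw [h2, Pi.sub_apply, h1, sub_self, abs_zero]
  have h1 := (hL (f - g)).trans (mul_nonpos_of_nonneg_of_nonpos hM h0)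
  rwa [abs_nonpos_iff, map_sub, sub_eq_zero] at h1

/-- Bounded functionals `L i` define an element of the `T`-strong dual. -/
def dualOf (L : ι → P.Linf →ₗ[ℝ] ℝ) (M : ι → ℝ) (hM : ∀ i, 0 ≤ M i)
    (hL : ∀ i f, |L i f| ≤ M i * P.coord (P.normInf f) i) : P.Dual :=
  ⟨{ toFun := P.ofFunctionals L
     map_add' := map_add _
     map_smul' := fun a f => P.coord_ext fun i => by
      rw [RingHom.id_apply, smul_eq_mul, map_mul, Pi.mul_apply, P.coord_ofFunctionals,
        P.coord_ofFunctionals, ← smul_eq_mul (P.coord a i), ← map_smul]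
      -- On `Ω_i` the element `a` is the constant `a_i`, so by locality multiplication by `a` may be
      -- replaced by the real scalar `a_i`.
      refine P.functional_eq_of_ae (hM i) (hL i) ?_
      have h := P.smul_ae (c := P.coord a) f.1 i
      rw [P.step_coord] at h
      filter_upwards [h, P.restrict_of_ae (AEEqFun.coeFn_smul (P.coord a i) f.1) i]
        with ω h1 h2
      exact h1.trans h2.symm }, by
    -- Regularity: `L i = K i - (K i - L i)` with `K i` the positive part. Both terms are positive,
    -- since `0` and `f` belong to `[0, f]`.
    choose K hK _ using fun i => P.exists_posPart (L i) (hM i) (hL i)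
    refine ⟨⟨P.ofFunctionals K, P.ofFunctionals fun i => K i - L i, fun f hf => ?_,
      fun f hf => ?_, fun f => P.coord_ext fun i => ?_⟩, P.coord.symm M,
      P.mem_boundSet.2 fun i => ?_⟩
    · rw [← P.coord_nonneg]
      intro i
      rw [P.coord_ofFunctionals]
      exact (hK i f hf).1 ⟨0, ⟨le_rfl, hf⟩, map_zero _⟩
    · rw [← P.coord_nonneg]
      intro i
      rw [P.coord_ofFunctionals]
      exact sub_nonneg.2 ((hK i f hf).1 ⟨f, ⟨hf, le_rfl⟩, rfl⟩)
    · change P.coord (P.ofFunctionals L f) i = _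
      rw [map_sub, Pi.sub_apply, P.coord_ofFunctionals, P.coord_ofFunctionals,
        P.coord_ofFunctionals, LinearMap.sub_apply, sub_sub_cancel]
    · rw [AlgEquiv.apply_symm_apply]
      refine ⟨hM i, fun f => ?_⟩
      change |P.coord (P.ofFunctionals L f) i| ≤ _
      rw [P.coord_ofFunctionals]
      exact hL i f⟩

theorem coord_dualOf {L : ι → P.Linf →ₗ[ℝ] ℝ} {M : ι → ℝ} {hM : ∀ i, 0 ≤ M i}
    {hL : ∀ i f, |L i f| ≤ M i * P.coord (P.normInf f) i} (f : P.Linf) (i : ι) :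
    P.coord ((P.dualOf L M hM hL).1 f) i = L i f :=
  P.coord_ofFunctionals L f i

/-- The functional `f ↦ (φ f)|_{Ω_i}`. -/
def functional (φ : P.Dual) (i : ι) : P.Linf →ₗ[ℝ] ℝ where
  toFun f := P.coord (φ.1 f) i
  map_add' f g := by rw [map_add, map_add, Pi.add_apply]
  map_smul' r f := by
    -- A real scalar acts through the constant function in `R(T)`, so `R(T)`-linearity includes real
    -- linearity.
    have h : r • f = algebraMap ℝ P.R r • f := (algebraMap_smul P.R r f).symm
    rw [h, map_smul, algebraMap_smul, map_smul]
    rfl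

theorem functional_congr (φ : P.Dual) {i : ι} {f g : P.Linf}
    (h : ∀ᵐ ω ∂(μ.restrict (P.cell i)), f.1 ω = g.1 ω) :
    P.coord (φ.1 f) i = P.coord (φ.1 g) i :=
  P.functional_eq_of_ae (L := P.functional φ i) (P.coord_dualNorm_nonneg φ i)
    (fun f => P.abs_coord_apply_le φ f i) h

theorem dual_ext {φ ψ : P.Dual} (h : ∀ f i, P.coord (φ.1 f) i = P.coord (ψ.1 f) i) : φ = ψ :=
  Subtype.ext <| LinearMap.ext fun f => P.coord_ext (h f)

theorem dual_le_iff {φ ψ : P.Dual} :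
    φ ≤ ψ ↔ ∀ f, 0 ≤ f → ∀ i, P.coord (φ.1 f) i ≤ P.coord (ψ.1 f) i :=
  forall₂_congr fun _ _ => P.coord_le.symm

theorem coord_add_apply (φ ψ : P.Dual) (f : P.Linf) (i : ι) :
    P.coord ((φ + ψ).1 f) i = P.coord (φ.1 f) i + P.coord (ψ.1 f) i :=
  congrFun (map_add P.coord (φ.1 f) (ψ.1 f)) i

theorem coord_sub_apply (φ ψ : P.Dual) (f : P.Linf) (i : ι) :
    P.coord ((φ - ψ).1 f) i = P.coord (φ.1 f) i - P.coord (ψ.1 f) i :=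
  congrFun (map_sub P.coord (φ.1 f) (ψ.1 f)) i

/-- The supremum is `ψ + (φ - ψ)⁺`, with the positive part taken separately on each cell. -/
theorem hasBinarySups_dual : HasBinarySups P.Dual := by
  intro φ ψ
  choose K hK hKb using fun i => P.exists_posPart (P.functional (φ - ψ) i)
    (P.coord_dualNorm_nonneg (φ - ψ) i) (fun f => P.abs_coord_apply_le (φ - ψ) f i)
  refine ⟨ψ + P.dualOf K _ (P.coord_dualNorm_nonneg (φ - ψ)) hKb, ?_, ?_⟩
  · rintro _ (rfl | rfl) <;> refine P.dual_le_iff.2 fun f hf i => ?_ <;>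
      rw [P.coord_add_apply, P.coord_dualOf]
    · have h := (hK i f hf).1 ⟨f, ⟨hf, le_rfl⟩, P.coord_sub_apply _ ψ f i⟩
      linarith
    · exact le_add_of_nonneg_right ((hK i f hf).1 ⟨0, ⟨le_rfl, hf⟩, map_zero _⟩)
  · intro w hw
    have h1 := P.dual_le_iff.1 (hw (Set.mem_insert φ {ψ}))
    have h2 := P.dual_le_iff.1 (hw (Set.mem_insert_of_mem φ rfl))
    refine P.dual_le_iff.2 fun f hf i => ?_
    rw [P.coord_add_apply, P.coord_dualOf, ← le_sub_iff_add_le']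
    refine (hK i f hf).2 ?_
    rintro _ ⟨g, hg, rfl⟩
    -- For `0 ≤ g ≤ f`, adding `φ g ≤ w g` and `ψ (f - g) ≤ w (f - g)` gives `(φ - ψ) g ≤ w f - ψ
    -- f`.
    have h3 := h1 g hg.1 i
    have h4 := h2 (f - g) (sub_nonneg.2 hg.2) i
    rw [map_sub, map_sub, map_sub, map_sub, Pi.sub_apply, Pi.sub_apply] at h4
    change P.coord ((φ - ψ).1 g) i ≤ _
    rw [P.coord_sub_apply]
    linarith

end Coordinates
section Pieces

universe u v

variable {Ω : Type u} [MeasurableSpace Ω] {μ : Measure Ω} {ι : Type v} [Countable ι]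
  (P : FinPartition μ ι)

/-! ### Restriction to a cell and extension by zero -/

theorem ae_comap_val {i : ι} {p : Ω → Prop} :
    (∀ᵐ ω : P.cell i ∂(μ.comap (Subtype.val : P.cell i → Ω)), p ω.1) ↔
      ∀ᵐ ω ∂(μ.restrict (P.cell i)), p ω :=
  (ae_restrict_iff_subtype (P.measurableSet_cell i)).symm

theorem coord_restrR (i : ι) (a : P.R) : (P.piece i).coord (P.restrR i a) () = P.coord a i := by
  have h : (P.restrR i a : P.cell i →ₘ[μ.comap (Subtype.val : P.cell i → Ω)] ℝ)
      = (P.piece i).step fun _ => P.coord a i := by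
    change P.restr i a.1 = _
    rw [← P.restr_step, P.step_coord]
  rw [(P.piece i).coord_eq h]

theorem coord_glueR (g : ∀ i, (P.piece i).R) (i : ι) :
    P.coord (P.glueR g) i = (P.piece i).coord (g i) () := by
  have h : (P.glueR g : Ω →ₘ[μ] ℝ) = P.step fun i => (P.piece i).coord (g i) () := by
    rw [← P.glue_step]
    simp only [(P.piece _).step_coord]
    rfl
  rw [P.coord_eq h]

theorem coord_normInf_restrLinf (i : ι) (f : P.Linf) :
    (P.piece i).coord ((P.piece i).normInf (P.restrLinf i f)) () = P.coord (P.normInf f) i := by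
  refine eq_of_forall_ge_iff fun x => ?_
  rw [(P.piece i).coord_normInf_le, P.coord_normInf_le, P.piece_ae, ← P.ae_comap_val]
  refine Filter.eventually_congr ?_
  filter_upwards [P.restr_ae i f.1] with ω h
  change |P.restr i f.1 ω| ≤ x ↔ _
  rw [h]

theorem restr_ext (i : ι) (f : P.cell i →ₘ[μ.comap (Subtype.val : P.cell i → Ω)] ℝ) :
    P.restr i (P.ext i f) = f := by
  refine P.restr_eq i ?_
  filter_upwards [P.restrict_of_ae (P.ext_ae i f) i] with ω h1 h
  rw [h1, extFun, dif_pos h]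

theorem restrLinf_extLinf (i : ι) (f : (P.piece i).Linf) :
    P.restrLinf i (P.extLinf i f) = f :=
  Subtype.ext (P.restr_ext i f.1)

theorem ext_restr_ae (i : ι) (f : Ω →ₘ[μ] ℝ) :
    ∀ᵐ ω ∂(μ.restrict (P.cell i)), P.ext i (P.restr i f) ω = f ω := by
  filter_upwards [P.restrict_of_ae (P.ext_ae i (P.restr i f)) i, P.ae_mem i,
    P.ae_val.1 (P.restr_ae i f)] with ω h1 h2 h3
  rw [h1, extFun, dif_pos h2, h3 h2]

theorem coord_normInf_extLinf (i : ι) (f : (P.piece i).Linf) :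
    P.coord (P.normInf (P.extLinf i f)) i = (P.piece i).coord ((P.piece i).normInf f) () := by
  rw [← P.coord_normInf_restrLinf, P.restrLinf_extLinf]

/-- The restriction `L^∞(T) → L^∞(T_i)` as a linear map. -/
def restrLinfₗ (i : ι) : P.Linf →ₗ[ℝ] (P.piece i).Linf where
  toFun := P.restrLinf i
  map_add' f g := Subtype.ext <| AEEqFun.ext <| by
    change P.restr i (f.1 + g.1) =ᵐ[_] (P.restr i f.1 + P.restr i g.1 : _ →ₘ[_] ℝ)
    filter_upwards [P.restr_ae i (f.1 + g.1), P.restr_ae i f.1, P.restr_ae i g.1,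
      AEEqFun.coeFn_add (P.restr i f.1) (P.restr i g.1),
      P.ae_comap_val.2 (P.restrict_of_ae (AEEqFun.coeFn_add f.1 g.1) i)] with ω h1 h2 h3 h4 h5
    rw [h1, h4, h5, Pi.add_apply, Pi.add_apply, h2, h3]
  map_smul' r f := Subtype.ext <| AEEqFun.ext <| by
    change P.restr i (r • f.1) =ᵐ[_] (r • P.restr i f.1 : _ →ₘ[_] ℝ)
    filter_upwards [P.restr_ae i (r • f.1), P.restr_ae i f.1,
      AEEqFun.coeFn_smul r (P.restr i f.1),
      P.ae_comap_val.2 (P.restrict_of_ae (AEEqFun.coeFn_smul r f.1) i)] with ω h1 h2 h4 h5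
    rw [h1, h4, h5, Pi.smul_apply, Pi.smul_apply, h2]

/-- This characterizes the extension by its restriction to the cell and its vanishing elsewhere;
linearity of extension follows from it. -/
theorem ext_eq (i : ι) {f : P.cell i →ₘ[μ.comap (Subtype.val : P.cell i → Ω)] ℝ}
    {g : Ω →ₘ[μ] ℝ} (h1 : P.restr i g = f)
    (h2 : ∀ᵐ ω ∂μ, ω ∉ P.cell i → g ω = 0) : P.ext i f = g := by
  subst h1
  refine AEEqFun.ext ?_
  filter_upwards [P.ext_ae i (P.restr i g), h2,
    (ae_restrict_iff' (P.measurableSet_cell i)).1 (P.ext_restr_ae i g)] with ω k1 k2 k3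
  by_cases h : ω ∈ P.cell i
  · exact k3 h
  · rw [k1, extFun, dif_neg h, k2 h]

theorem ext_ae_zero (i : ι) (f : P.cell i →ₘ[μ.comap (Subtype.val : P.cell i → Ω)] ℝ) :
    ∀ᵐ ω ∂μ, ω ∉ P.cell i → P.ext i f ω = 0 := by
  filter_upwards [P.ext_ae i f] with ω h1 h
  rw [h1, extFun, dif_neg h]

/-- The extension by zero `L^∞(T_i) → L^∞(T)` as a linear map. -/
def extLinfₗ (i : ι) : (P.piece i).Linf →ₗ[ℝ] P.Linf where
  toFun := P.extLinf i
  map_add' f g := Subtype.ext <| by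
    refine P.ext_eq i (congrArg Subtype.val (?_ : P.restrLinf i (P.extLinf i f + P.extLinf i g)
      = f + g)) ?_
    · refine (map_add (P.restrLinfₗ i) _ _).trans ?_
      exact congrArg₂ _ (P.restrLinf_extLinf i f) (P.restrLinf_extLinf i g)
    · filter_upwards [P.ext_ae_zero i f.1, P.ext_ae_zero i g.1,
        AEEqFun.coeFn_add (P.ext i f.1) (P.ext i g.1)] with ω h1 h2 h3 h
      refine h3.trans ?_
      rw [Pi.add_apply, h1 h, h2 h, add_zero]
  map_smul' r f := Subtype.ext <| by
    refine P.ext_eq i (congrArg Subtype.val (?_ : P.restrLinf i (r • P.extLinf i f)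
      = r • f)) ?_
    · refine (map_smul (P.restrLinfₗ i) _ _).trans ?_
      exact congrArg _ (P.restrLinf_extLinf i f)
    · filter_upwards [P.ext_ae_zero i f.1, AEEqFun.coeFn_smul r (P.ext i f.1)] with ω h1 h3 h
      refine h3.trans ?_
      rw [Pi.smul_apply, h1 h, smul_zero]

theorem restrLinf_nonneg (i : ι) {f : P.Linf} (hf : 0 ≤ f) : 0 ≤ P.restrLinf i f := by
  change (0 : Ω →ₘ[μ] ℝ) ≤ f.1 at hf
  change (0 : P.cell i →ₘ[μ.comap (Subtype.val : P.cell i → Ω)] ℝ) ≤ P.restr i f.1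
  rw [← AEEqFun.coeFn_le] at hf ⊢
  filter_upwards [AEEqFun.coeFn_zero (μ := μ.comap (Subtype.val : P.cell i → Ω)) (β := ℝ),
    P.restr_ae i f.1, P.ae_comap_val.2 (P.restrict_of_ae hf i),
    P.ae_comap_val.2 (P.restrict_of_ae (AEEqFun.coeFn_zero (μ := μ) (β := ℝ)) i)]
    with ω h1 h2 h3 h4
  rw [h1, h2]
  rwa [h4] at h3

theorem extLinf_nonneg (i : ι) {f : (P.piece i).Linf} (hf : 0 ≤ f) : 0 ≤ P.extLinf i f := by
  change (0 : P.cell i →ₘ[μ.comap (Subtype.val : P.cell i → Ω)] ℝ) ≤ f.1 at hf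
  change (0 : Ω →ₘ[μ] ℝ) ≤ P.ext i f.1
  rw [← AEEqFun.coeFn_le] at hf ⊢
  filter_upwards [P.ext_ae i f.1, AEEqFun.coeFn_zero (μ := μ) (β := ℝ),
    (ae_restrict_iff' (P.measurableSet_cell i)).1 (P.ae_val.1 hf),
    (ae_restrict_iff' (P.measurableSet_cell i)).1 (P.ae_val.1 (AEEqFun.coeFn_zero (β := ℝ)))]
    with ω h1 h2 h3 h4
  rw [h1, h2, extFun]
  split_ifs with h
  · have h3 := h3 h h
    rwa [h4 h h] at h3
  · exact le_rfl

/-! ### The isomorphism, its isometry and its order properties -/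

/-- The map `Φ`, gluing local functionals. -/
def glueDual (φ : P.ProdDual) : P.Dual :=
  P.dualOf (fun i => ((P.piece i).functional (φ i) ()).comp (P.restrLinfₗ i))
    (fun i => (P.piece i).coord ((P.piece i).dualNorm (φ i)) ())
    (fun i => (P.piece i).coord_dualNorm_nonneg (φ i) ())
    (fun i f => by
      rw [← P.coord_normInf_restrLinf]
      exact (P.piece i).abs_coord_apply_le (φ i) (P.restrLinf i f) ())

theorem coord_glueDual (φ : P.ProdDual) (f : P.Linf) (i : ι) :
    P.coord ((P.glueDual φ).1 f) i = (P.piece i).coord ((φ i).1 (P.restrLinf i f)) () :=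
  P.coord_dualOf f i

/-- The map `Ψ`, restricting a functional to the cells. -/
def restrDual (φ : P.Dual) : P.ProdDual := fun i =>
  (P.piece i).dualOf (fun _ => (P.functional φ i).comp (P.extLinfₗ i))
    (fun _ => P.coord (P.dualNorm φ) i)
    (fun _ => P.coord_dualNorm_nonneg φ i)
    (fun _ f => by
      refine (P.abs_coord_apply_le φ (P.extLinf i f) i).trans_eq ?_
      rw [P.coord_normInf_extLinf])

theorem coord_restrDual (φ : P.Dual) (i : ι) (f : (P.piece i).Linf) :
    (P.piece i).coord ((P.restrDual φ i).1 f) () = P.coord (φ.1 (P.extLinf i f)) i :=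
  (P.piece i).coord_dualOf f ()

/-- The linear isomorphism between the product of the `T_i`-strong duals and the `T`-strong
dual. -/
def dualEquiv : P.ProdDual ≃ₗ[P.R] P.Dual where
  toFun := P.glueDual
  invFun := P.restrDual
  map_add' φ ψ := P.dual_ext fun f i => by
    rw [P.coord_add_apply, P.coord_glueDual, P.coord_glueDual, P.coord_glueDual]
    exact (P.piece i).coord_add_apply (φ i) (ψ i) _ ()
  map_smul' a φ := P.dual_ext fun f i => by
    rw [P.coord_glueDual]
    change (P.piece i).coord (P.restrR i a * (φ i).1 (P.restrLinf i f)) () =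
      P.coord (a * (P.glueDual φ).1 f) i
    rw [map_mul, map_mul, Pi.mul_apply, Pi.mul_apply, P.coord_restrR, P.coord_glueDual]
  left_inv φ := funext fun i => (P.piece i).dual_ext fun f _ => by
    rw [P.coord_restrDual, P.coord_glueDual, P.restrLinf_extLinf]
  right_inv φ := P.dual_ext fun f i => by
    rw [P.coord_glueDual, P.coord_restrDual]
    -- Cutting `f` down to `Ω_i` and extending by zero changes `f` only off `Ω_i`, which the `i`-th
    -- functional of `φ` does not see.
    exact P.functional_congr φ (P.ext_restr_ae i f.1)

theorem dualEquiv_apply (φ : P.ProdDual) (f : P.Linf) :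
    (P.dualEquiv φ).1 f = P.glueR fun i => (φ i).1 (P.restrLinf i f) :=
  P.coord_ext fun i => by
    rw [P.coord_glueR]
    exact P.coord_glueDual φ f i

theorem dualEquiv_symm_apply (φ : P.Dual) (i : ι) (f : (P.piece i).Linf) :
    (P.dualEquiv.symm φ i).1 f = P.restrR i (φ.1 (P.extLinf i f)) :=
  (P.piece i).coord_ext fun _ => by
    rw [P.coord_restrR]
    exact P.coord_restrDual φ i f

/-- On each cell both norms have the same upper bounds `x`: test functions on `Ω` restrict to `Ω_i`,
those on `Ω_i` extend by zero, and the norm on the cell is unchanged either way. -/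
theorem dualNorm_dualEquiv (φ : P.ProdDual) : P.dualNorm (P.dualEquiv φ) = P.prodNorm φ := by
  refine P.coord_ext fun i => eq_of_forall_ge_iff fun x => ?_
  rw [prodNorm, P.coord_glueR, P.coord_dualNorm_le, (P.piece i).coord_dualNorm_le]
  refine and_congr_right fun _ => ⟨fun h f => ?_, fun h f => ?_⟩
  · have := h (P.extLinf i f)
    rwa [P.dualEquiv_apply, P.coord_glueR, P.restrLinf_extLinf, P.coord_normInf_extLinf] at this
  · rw [P.dualEquiv_apply, P.coord_glueR, ← P.coord_normInf_restrLinf]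
    exact h _

/-- Extension by zero and restriction both preserve positive functions, so positivity can be tested
on either side. -/
theorem dualEquiv_le_iff {φ ψ : P.ProdDual} : P.dualEquiv φ ≤ P.dualEquiv ψ ↔ φ ≤ ψ := by
  constructor
  · intro h i
    refine (P.piece i).dual_le_iff.2 fun f hf _ => ?_
    have := P.dual_le_iff.1 h _ (P.extLinf_nonneg i hf) i
    rwa [P.dualEquiv_apply, P.dualEquiv_apply, P.coord_glueR, P.coord_glueR,
      P.restrLinf_extLinf] at this
  · intro h
    refine P.dual_le_iff.2 fun f hf i => ?_
    rw [P.dualEquiv_apply, P.dualEquiv_apply, P.coord_glueR, P.coord_glueR]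
    exact (P.piece i).dual_le_iff.1 (h i) _ (P.restrLinf_nonneg i hf) ()

theorem hasBinarySups_prodDual : HasBinarySups P.ProdDual := by
  intro φ ψ
  choose χ hχ using fun i => (P.piece i).hasBinarySups_dual (φ i) (ψ i)
  refine ⟨χ, isLUB_pi.2 fun i => ?_⟩
  rw [Set.image_pair]
  exact hχ i

end Pieces

end FinPartition

/-! ### Assembling the theorem -/

theorem preservesBinarySups_orderIso {E F : Type*} [PartialOrder E] [PartialOrder F]
    (e : E ≃o F) : PreservesBinarySups e := fun x y z h => by
  rw [← Set.image_pair]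
  exact e.isLUB_image'.2 h

end StrongDual

end

theorem mainTheorem8 {Ω : Type*} [MeasurableSpace Ω] (μ : MeasureTheory.Measure Ω)
    [MeasureTheory.SigmaFinite μ] {ι : Type*} [Countable ι]
    (P : StrongDual.FinPartition μ ι) :
    -- (a) gluing the local functionals
    (∀ φ : P.ProdDual, ∃ φ' : P.Dual,
      (∀ f : P.Linf, φ'.1 f = P.glueR fun i => (φ i).1 (P.restrLinf i f)) ∧
        P.dualNorm φ' ≤ P.prodNorm φ) ∧
    -- (b) restricting a functional to the cells
    (∀ φ : P.Dual, ∃ ψ : P.ProdDual,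
      (∀ (i : ι) (f : (P.piece i).Linf), (ψ i).1 f = P.restrR i (φ.1 (P.extLinf i f))) ∧
        P.prodNorm ψ ≤ P.dualNorm φ) ∧
    -- (c) both spaces are Riesz spaces, and the two maps are mutually inverse `R(T)`-linear
    -- isometric Riesz isomorphisms
    StrongDual.HasBinarySups P.ProdDual ∧ StrongDual.HasBinarySups P.Dual ∧
    ∃ Φ : P.ProdDual ≃ₗ[P.R] P.Dual,
      (∀ (φ : P.ProdDual) (f : P.Linf),
        (Φ φ).1 f = P.glueR fun i => (φ i).1 (P.restrLinf i f)) ∧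
      (∀ (φ : P.Dual) (i : ι) (f : (P.piece i).Linf),
        (Φ.symm φ i).1 f = P.restrR i (φ.1 (P.extLinf i f))) ∧
      StrongDual.PreservesBinarySups Φ ∧ StrongDual.PreservesBinarySups Φ.symm ∧
      (∀ φ : P.ProdDual, P.dualNorm (Φ φ) = P.prodNorm φ) ∧
      (∀ φ : P.Dual, P.prodNorm (Φ.symm φ) = P.dualNorm φ) := by
  have hsymm : ∀ φ : P.Dual, P.prodNorm (P.dualEquiv.symm φ) = P.dualNorm φ := fun φ => by
    rw [← P.dualNorm_dualEquiv, LinearEquiv.apply_symm_apply]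
  -- A bijection preserving the order in both directions preserves suprema, as does its inverse;
  -- this supplies the Riesz homomorphism property for both maps.
  let e : P.ProdDual ≃o P.Dual := ⟨P.dualEquiv.toEquiv, P.dualEquiv_le_iff⟩
  exact ⟨fun φ => ⟨P.dualEquiv φ, P.dualEquiv_apply φ, (P.dualNorm_dualEquiv φ).le⟩,
    fun φ => ⟨P.dualEquiv.symm φ, P.dualEquiv_symm_apply φ, (hsymm φ).le⟩,
    P.hasBinarySups_prodDual, P.hasBinarySups_dual, P.dualEquiv, P.dualEquiv_apply,
    P.dualEquiv_symm_apply, StrongDual.preservesBinarySups_orderIso e,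
    StrongDual.preservesBinarySups_orderIso e.symm, P.dualNorm_dualEquiv, hsymm⟩
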